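/- Let $Z$ be a metric space (not necessarily complete or separable). Let $\operatorname{Lip}_{\mathrm{loc}}(Z)$ be the space of functions $Z\to\mathbb R$ that are Lipschitz on bounded sets and $\operatorname{Lip}_{\mathrm{bs}}(Z)$ the space of Lipschitz functions with bounded support. An $m$-dimensional metric functional ($m\ge 0$) is a multilinear function $T\colon \operatorname{Lip}_{\mathrm{bs}}(Z)\times[\operatorname{Lip}_{\mathrm{loc}}(Z)]^m\to\mathbb R$ such that (a) $T(f,\pi^j)\to T(f,\pi)$ whenever $\pi_i^j\to\pi_i$ pointwise and $\sup_{i,j}\operatorname{Lip}(\pi_i^j|_B)<\infty$ for every bounded $B\subset Z$; and (b) $T(f,\pi)=0$ whenever some $\pi_i$ is constant on $\{z: d(z,\operatorname{spt} f)\le\delta\}$ for some $\delta>0$. If $m\ge1$, its boundary is $\partial T(f,\pi_1,\dots,\pi_{m-1}):=T(\sigma,f,\pi_1,\dots,\pi_{m-1})$ for any $\sigma\in\operatorname{Lip}_{\mathrm{bs}}(Z)$ with $\sigma=1$ on $\operatorname{spt} f$. For open $V\subset Z$ let $\mathbf M_V(T)$ be the supremum of $\sum_\lambda T(f_\lambda,\pi_\lambda)$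 over all finite families with $f_\lambda\in\operatorname{Lip}_{\mathrm{bs}}(Z)$, $\operatorname{spt} f_\lambda\subset V$, $\sum_\lambda|f_\lambda|\le1$ and all components of $\pi_\lambda$ $1$-Lipschitz. For $A\subset Z$ put $\|T\|(A):=\inf\{\mathbf M_V(T): V\text{ open},\ A\subset V\}$, and let $\operatorname{spt}T:=\{z:\|T\|(\bar B(z,r))>0\ \forall r>0\}$. A metric functional $T$ has locally finite mass if for every bounded open $U\subset Z$ and $\epsilon>0$ there is a compact $C\subset U$ with $\mathbf M_U(T)<\infty$ and $\mathbf M_{U\setminus C}(T)<\epsilon$; then $\|T\|$ is a measure on Borel sets, and $T$ extends to bounded Borel functions $f$ with bounded support by $T(f,\pi):=\lim_k T(f_k,\pi)$, where $f_k\in\operatorname{Lip}_{\mathrm{bs}}(Z)$ have supports in a common bounded set and $f_k\to f$ in $L^1(\|T\|)$. For a Borel set $B$ put $(T\llcorner B)(f,\pi):=T(1_Bf,\pi)$. An $m$-dimensional metric functional $T$ is called a locally normal $m$-current if $T$ and (when $m\ge1$) $\partial T$ have locally finite mass. **Theorem.** Let $T$ be a locally normal $m$-current on $Z$ with $m\ge1$,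 and let $\varrho\colon Z\to\mathbb R$ be Lipschitz, with least Lipschitz constant $\operatorname{Lip}(\varrho)$. For $r\in\mathbb R$ let $$\langle T,\varrho,r\rangle:=\partial(T\llcorner\{\varrho\le r\})-(\partial T)\llcorner\{\varrho\le r\}.$$ Then for almost every $r\in\mathbb R$ the slice $\langle T,\varrho,r\rangle$ is a locally normal $(m-1)$-current with $$\operatorname{spt}\langle T,\varrho,r\rangle\subset\{\varrho=r\}\cap\operatorname{spt}T.$$ Moreover, for every Borel set $A\subset Z$ the function $r\mapsto\|\langle T,\varrho,r\rangle\|(A)\in[0,\infty]$ is Lebesgue measurable, and for all $-\infty<r_0<r_1<\infty$, $$\int_{r_0}^{r_1}\|\langle T,\varrho,r\rangle\|(A)\,dr\le\operatorname{Lip}(\varrho)\,\|T\|(A\cap\{r_0<\varrho<r_1\}),$$ where $0\cdot\infty:=0$. -/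

import Mathlib

open Set Filter Topology MeasureTheory
open scoped NNReal ENNReal

namespace MetricCurrent

noncomputable section

/-- The vector space of real functions on `Z` that are Lipschitz on every bounded set. -/
def Liploc (Z : Type*) [MetricSpace Z] : Submodule ℝ (Z → ℝ) where
  carrier := {f | ∀ B : Set Z, Bornology.IsBounded B → ∃ K : ℝ≥0, LipschitzOnWith K f B}
  zero_mem' := fun _ _ => ⟨0, (LipschitzWith.const (0 : ℝ)).lipschitzOnWith⟩
  add_mem' := by
    intro f g hf hg B hB
    obtain ⟨K, hK⟩ := hf B hB
    obtain ⟨L, hL⟩ := hg B hB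
    exact ⟨K + L, hK.add hL⟩
  smul_mem' := by
    intro c f hf B hB
    obtain ⟨K, hK⟩ := hf B hB
    exact ⟨‖c‖₊ * K, (lipschitzWith_smul c).comp_lipschitzOnWith hK⟩

/-- The vector space of (bounded) Lipschitz functions on `Z` with bounded support.
A Lipschitz function with bounded support is automatically bounded. -/
def Lipbs (Z : Type*) [MetricSpace Z] : Submodule ℝ (Z → ℝ) where
  carrier := {f | (∃ K : ℝ≥0, LipschitzWith K f) ∧ Bornology.IsBounded (tsupport f)}
  zero_mem' := by
    refine ⟨⟨0, LipschitzWith.const (0 : ℝ)⟩, ?_⟩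
    have h : tsupport (0 : Z → ℝ) = ∅ := tsupport_eq_empty_iff.2 rfl
    rw [h]
    exact Bornology.isBounded_empty
  add_mem' := by
    rintro f g ⟨⟨K, hK⟩, hf⟩ ⟨⟨L, hL⟩, hg⟩
    exact ⟨⟨K + L, hK.add hL⟩, (hf.union hg).subset (tsupport_add f g)⟩
  smul_mem' := by
    rintro c f ⟨⟨K, hK⟩, hf⟩
    refine ⟨⟨‖c‖₊ * K, (lipschitzWith_smul c).comp hK⟩, hf.subset ?_⟩
    exact closure_mono (Function.support_const_smul_subset c f)

variable {Z : Type*} [MetricSpace Z]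

/-- The inclusion of Lipschitz functions with bounded support into the functions that are
Lipschitz on bounded sets. -/
def Lipbs.toLiploc (f : Lipbs Z) : Liploc Z :=
  ⟨f.1, fun _ _ => f.2.1.imp fun _ hK => hK.lipschitzOnWith⟩

/-- Real functions of tuples `(f, π₁, …, πₘ)`, where `f` is Lipschitz with bounded support and
the `πᵢ` are Lipschitz on bounded sets. -/
abbrev FormFunction (Z : Type*) [MetricSpace Z] (m : ℕ) : Type _ :=
  Lipbs Z → (Fin m → Liploc Z) → ℝ

/-- `m`-dimensional metric functionals: multilinear, continuous and local. -/
structure IsMetricFunctional {m : ℕ} (T : FormFunction Z m) : Prop where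
  linear_left : ∀ π : Fin m → Liploc Z, IsLinearMap ℝ (fun f : Lipbs Z => T f π)
  linear_right : ∀ (f : Lipbs Z) (π : Fin m → Liploc Z) (i : Fin m),
    IsLinearMap ℝ (fun p : Liploc Z => T f (Function.update π i p))
  continuous : ∀ (f : Lipbs Z) (π : Fin m → Liploc Z) (πs : ℕ → Fin m → Liploc Z),
    (∀ i z, Tendsto (fun j => (πs j i : Z → ℝ) z) atTop (𝓝 ((π i : Z → ℝ) z))) →
    (∀ B : Set Z, Bornology.IsBounded B →
      ∃ K : ℝ≥0, ∀ j i, LipschitzOnWith K (πs j i : Z → ℝ) B) →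
    Tendsto (fun j => T f (πs j)) atTop (𝓝 (T f π))
  local' : ∀ (f : Lipbs Z) (π : Fin m → Liploc Z),
    (∃ (i : Fin m) (δ : ℝ), 0 < δ ∧
      ∃ c : ℝ, ∀ z ∈ Metric.cthickening δ (tsupport (f : Z → ℝ)), (π i : Z → ℝ) z = c) →
    T f π = 0

/-- The finite families `(f_l, π_l)` that are admitted in the definition of the mass in `V`. -/
structure IsMassFamily {m n : ℕ} (V : Set Z) (f : Fin n → Lipbs Z)
    (π : Fin n → Fin m → Liploc Z) : Prop where
  lipschitz : ∀ l i, LipschitzWith 1 (π l i : Z → ℝ)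
  support_subset : ∀ l, tsupport (f l : Z → ℝ) ⊆ V
  sum_le_one : ∀ z, ∑ l, |(f l : Z → ℝ) z| ≤ 1

/-- The mass `M_V(T)` of `T` in an open set `V`. The empty family is admitted, so that the supremum
is nonnegative and nothing is lost in passing to nonnegative extended reals. -/
def massIn {m : ℕ} (T : FormFunction Z m) (V : Set Z) : ℝ≥0∞ :=
  ⨆ (n : ℕ) (f : Fin n → Lipbs Z) (π : Fin n → Fin m → Liploc Z) (_ : IsMassFamily V f π),
    ENNReal.ofReal (∑ l, T (f l) (π l))

/-- The set function `‖T‖`. -/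
def mass {m : ℕ} (T : FormFunction Z m) (A : Set Z) : ℝ≥0∞ :=
  ⨅ (V : Set Z) (_ : IsOpen V) (_ : A ⊆ V), massIn T V

/-- The support of `T`, that is, the support of `‖T‖`. -/
def spt {m : ℕ} (T : FormFunction Z m) : Set Z :=
  {z | ∀ r : ℝ, 0 < r → 0 < mass T (Metric.closedBall z r)}

/-- Metric currents with locally finite mass. -/
structure IsLocallyFiniteMass {m : ℕ} (T : FormFunction Z m) : Prop where
  isMetricFunctional : IsMetricFunctional T
  tight : ∀ U : Set Z, IsOpen U → Bornology.IsBounded U → ∀ ε : ℝ≥0∞, 0 < ε →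
    ∃ C : Set Z, IsCompact C ∧ C ⊆ U ∧ massIn T U < ∞ ∧ massIn T (U \ C) < ε

theorem exists_cutoff (f : Lipbs Z) :
    ∃ σ : Lipbs Z, ∀ z ∈ tsupport (f : Z → ℝ), (σ : Z → ℝ) z = 1 := by
  rcases (tsupport (f : Z → ℝ)).eq_empty_or_nonempty with h | h
  · exact ⟨0, by simp [h]⟩
  · have hL : LipschitzWith 1
        (fun z => max (1 - Metric.infDist z (tsupport (f : Z → ℝ))) 0) := by
      have h1 : LipschitzWith (0 + 1)
          (fun z => 1 - Metric.infDist z (tsupport (f : Z → ℝ))) :=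
        (LipschitzWith.const (1 : ℝ)).sub (Metric.lipschitz_infDist_pt _)
      rw [zero_add] at h1
      exact h1.max_const 0
    refine ⟨⟨_, ⟨1, hL⟩, ?_⟩, ?_⟩
    · refine (f.2.2.cthickening (δ := 1)).subset ?_
      refine closure_minimal ?_ Metric.isClosed_cthickening
      intro z hz
      have hz' : max (1 - Metric.infDist z (tsupport (f : Z → ℝ))) 0 ≠ 0 := hz
      have h2 : Metric.infDist z (tsupport (f : Z → ℝ)) < 1 := by
        by_contra! hcon
        exact hz' (max_eq_right (by linarith))
      exact Metric.thickening_subset_cthickening 1 _ ((Metric.mem_thickening_iff_infDist_lt h).2 h2)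
    · intro z hz
      simp [Metric.infDist_zero_of_mem hz]

/-- A function in `Lipbs Z` that is equal to `1` on the support of `f`. -/
def cutoff (f : Lipbs Z) : Lipbs Z := (exists_cutoff f).choose

/-- The boundary `∂T(f, π) = T(σ, f, π)`, where `σ = 1` on the support of `f`.
If `T` is a metric functional, then the value does not depend on the choice of `σ`. -/
def boundary {m : ℕ} (T : FormFunction Z (m + 1)) : FormFunction Z m :=
  fun f π => T (cutoff f) (Fin.cons (Lipbs.toLiploc f) π)

/-- Locally normal currents. -/
def IsLocallyNormal : {m : ℕ} → FormFunction Z m → Prop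
  | 0, T => IsLocallyFiniteMass T
  | _ + 1, T => IsLocallyFiniteMass T ∧ IsLocallyFiniteMass (boundary T)

/-- The least Lipschitz constant of a Lipschitz function. -/
def lipConst (f : Z → ℝ) : ℝ≥0 := sInf {K : ℝ≥0 | LipschitzWith K f}

variable [MeasurableSpace Z]

open Classical in
/-- The Borel measure that agrees with the set function `‖T‖` on Borel sets. It exists whenever
`T` has locally finite mass (and is set to zero if there is no such measure). -/
def massMeasure {m : ℕ} (T : FormFunction Z m) : Measure Z :=
  if h : ∃ μ : Measure Z, ∀ B : Set Z, MeasurableSet B → μ B = mass T B then h.choose else 0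

/-- The sequence `u` in `Lipbs Z`, with supports in one bounded set, converges to `f` in
`L¹(‖T‖)`. -/
structure IsApprox {m : ℕ} (T : FormFunction Z m) (f : Z → ℝ) (u : ℕ → Lipbs Z) : Prop where
  support_subset : ∃ N : Set Z, Bornology.IsBounded N ∧ ∀ k, tsupport (u k : Z → ℝ) ⊆ N
  tendsto : Tendsto (fun k => ∫⁻ z, ENNReal.ofReal |(u k : Z → ℝ) z - f z| ∂(massMeasure T))
    atTop (𝓝 0)

open Classical in
/-- The extension of `T` to bounded Borel functions `f` with bounded support: the limit of
`T(u_k, π)` for a sequence `u_k` in `Lipbs Z` that converges to `f` in `L¹(‖T‖)`.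
If `T` has locally finite mass, such a sequence exists, the limit exists, and it does not depend on
the sequence. -/
def extend {m : ℕ} (T : FormFunction Z m) (f : Z → ℝ) (π : Fin m → Liploc Z) : ℝ :=
  if h : ∃ u : ℕ → Lipbs Z, IsApprox T f u then limUnder atTop (fun k => T (h.choose k) π) else 0

/-- The restriction of `T` to a Borel set `A`, that is, `(f, π) ↦ T(1_A f, π)`. -/
def restrict {m : ℕ} (T : FormFunction Z m) (A : Set Z) : FormFunction Z m :=
  fun f π => extend T (A.indicator (f : Z → ℝ)) π

/-- The (right-handed) slice of `T` at `r` with respect to `ρ`. -/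
def slice {m : ℕ} (T : FormFunction Z (m + 1)) (ρ : Z → ℝ) (r : ℝ) : FormFunction Z m :=
  boundary (restrict T {z | ρ z ≤ r}) - restrict (boundary T) {z | ρ z ≤ r}

end

end MetricCurrent

namespace MetricCurrent

/-! ### Elementary calculus of Lipschitz functions and cutoffs -/

noncomputable section

variable {Z : Type*} [MetricSpace Z]

/-! The slice is a limit of `T` itself. Let γ_n be the ramp growing from 0 to 1 on [r, r + 1/(n+1)].
The product rule gives ⟨T,ρ,r⟩(f,π) = lim T(f, γ_n∘ρ, π) (`IsTight.tendsto_slice`). Now γ_n∘ρ is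
(n+1)Lip(ρ)-Lipschitz and, by locality, only the strip where ρ lies in [r, r + 1/(n+1)] contributes.
Hence the mass of the slice in V is at most the liminf of (n+1) Lip(ρ) ‖T‖(V ∩ strip)
(`IsTight.massIn_slice_le`). This bound locates the support. Integrated in r with Fatou and Fubini
it gives the coarea inequality for V, and outer regularity of ‖T‖ extends it to Borel sets.

Everything rests on the estimate |T(f,π)| ≤ ∏ Lip(π_i) ∫ |f| d‖T‖ (`IsTight.enorm_le`), for which
‖T‖ must first be shown to be a Borel measure. It yields the product rule (`IsTight.product_rule`)
and the extension of `T` to functions 1_{ρ ≤ r} f.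

Finite mass and tightness of almost every slice follow by integrating the coarea bound over bounded
open sets U and over U \ C with C compact. The boundary of a slice is minus the slice of ∂T, so it
is covered by the same argument. For measurability, r ↦ ⟨T,ρ,r⟩(f,π) is right-continuous, which
makes the uncountable supremum M_V Borel in r; a π-λ argument then handles Borel sets. -/

theorem exists_abs_le_of_lipschitzOnWith {g : Z → ℝ} {B : Set Z} {K : ℝ≥0}
    (hB : Bornology.IsBounded B) (hg : LipschitzOnWith K g B) :
    ∃ M : ℝ, 0 ≤ M ∧ ∀ z ∈ B, |g z| ≤ M := by
  rcases B.eq_empty_or_nonempty with rfl | ⟨b, hb⟩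
  · exact ⟨0, le_rfl, by simp⟩
  · obtain ⟨R, hR⟩ := Metric.isBounded_iff.1 hB
    refine ⟨|g b| + K * R, ?_, fun z hz => ?_⟩
    · have := hR hb hb
      rw [dist_self] at this
      positivity
    · have h1 := hg.dist_le_mul z hz b hb
      rw [Real.dist_eq] at h1
      have h2 : (K : ℝ) * dist z b ≤ K * R := mul_le_mul_of_nonneg_left (hR hz hb) K.2
      have h3 := abs_sub_abs_le_abs_sub (g z) (g b)
      linarith

theorem Liploc.exists_lipschitzOnWith (g : Liploc Z) {B : Set Z} (hB : Bornology.IsBounded B) :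
    ∃ K : ℝ≥0, LipschitzOnWith K g.1 B := g.2 B hB

theorem Liploc.exists_abs_le (g : Liploc Z) {B : Set Z} (hB : Bornology.IsBounded B) :
    ∃ M : ℝ, 0 ≤ M ∧ ∀ z ∈ B, |g.1 z| ≤ M :=
  exists_abs_le_of_lipschitzOnWith hB (Liploc.exists_lipschitzOnWith g hB).choose_spec

theorem Lipbs.eq_zero (f : Lipbs Z) {z : Z} (hz : z ∉ tsupport f.1) : f.1 z = 0 :=
  image_eq_zero_of_notMem_tsupport hz

theorem Lipbs.exists_abs_le (f : Lipbs Z) : ∃ M : ℝ, 0 ≤ M ∧ ∀ z, |f.1 z| ≤ M := by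
  obtain ⟨K, hK⟩ := f.2.1
  obtain ⟨M, hM, h⟩ := exists_abs_le_of_lipschitzOnWith f.2.2 (hK.lipschitzOnWith (s := tsupport f.1))
  refine ⟨M, hM, fun z => ?_⟩
  by_cases hz : z ∈ tsupport f.1
  · exact h z hz
  · rw [Lipbs.eq_zero f hz, abs_zero]; exact hM

theorem Lipbs.continuous (f : Lipbs Z) : Continuous f.1 := f.2.1.choose_spec.continuous

theorem abs_mul_sub_mul_le {a b c d A B : ℝ} (ha : |a| ≤ A) (hd : |d| ≤ B) :
    |a * b - c * d| ≤ A * |b - d| + B * |a - c| := by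
  have : a * b - c * d = a * (b - d) + d * (a - c) := by ring
  rw [this]
  refine (abs_add_le _ _).trans ?_
  rw [abs_mul, abs_mul]
  gcongr

theorem lipschitzOnWith_mul {f g : Z → ℝ} {B : Set Z} {K L M N : ℝ≥0}
    (hf : LipschitzOnWith K f B) (hg : LipschitzOnWith L g B)
    (hM : ∀ z ∈ B, |f z| ≤ M) (hN : ∀ z ∈ B, |g z| ≤ N) :
    LipschitzOnWith (M * L + N * K) (fun z => f z * g z) B := by
  refine LipschitzOnWith.of_dist_le_mul fun x hx y hy => ?_
  have h1 := hf.dist_le_mul x hx y hy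
  have h2 := hg.dist_le_mul x hx y hy
  rw [Real.dist_eq] at *
  refine (abs_mul_sub_mul_le (hM x hx) (hN y hy)).trans ?_
  push_cast
  rw [add_mul, mul_assoc, mul_assoc]
  gcongr

/-- The product of two functions that are Lipschitz on bounded sets. -/
def Liploc.mul (g h : Liploc Z) : Liploc Z :=
  ⟨fun z => g.1 z * h.1 z, fun B hB => by
    obtain ⟨K, hK⟩ := g.2 B hB
    obtain ⟨L, hL⟩ := h.2 B hB
    obtain ⟨M, hM, hM'⟩ := Liploc.exists_abs_le g hB
    obtain ⟨N, hN, hN'⟩ := Liploc.exists_abs_le h hB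
    exact ⟨_, lipschitzOnWith_mul (M := ⟨M, hM⟩) (N := ⟨N, hN⟩) hK hL hM' hN'⟩⟩

/-- The composition of a Lipschitz function with a function that is Lipschitz on bounded sets. -/
def Liploc.comp (g : Liploc Z) (φ : ℝ → ℝ) (hφ : ∃ K : ℝ≥0, LipschitzWith K φ) : Liploc Z :=
  ⟨fun z => φ (g.1 z), fun B hB => by
    obtain ⟨L, hL⟩ := g.2 B hB
    obtain ⟨K, hK⟩ := hφ
    exact ⟨K * L, hK.comp_lipschitzOnWith hL⟩⟩

/-- A Lipschitz function, viewed as a function that is Lipschitz on bounded sets. -/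
def Liploc.ofLipschitz (g : Z → ℝ) (hg : ∃ K : ℝ≥0, LipschitzWith K g) : Liploc Z :=
  ⟨g, fun _ _ => hg.imp fun _ h => h.lipschitzOnWith⟩

/-- Constant functions. -/
def Liploc.const (Z : Type*) [MetricSpace Z] (c : ℝ) : Liploc Z :=
  Liploc.ofLipschitz (fun _ => c) ⟨0, LipschitzWith.const c⟩

theorem tsupport_mul_left_subset (f g : Z → ℝ) : tsupport (fun z => f z * g z) ⊆ tsupport f :=
  closure_mono fun z hz => by
    rw [Function.mem_support] at hz ⊢
    exact left_ne_zero_of_mul hz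

/-- The product of a Lipschitz function with bounded support and a function that is Lipschitz on
bounded sets. -/
def Lipbs.mul (f : Lipbs Z) (g : Liploc Z) : Lipbs Z :=
  ⟨fun z => f.1 z * g.1 z, by
    refine ⟨?_, f.2.2.subset (tsupport_mul_left_subset _ _)⟩
    obtain ⟨K, hK⟩ := f.2.1
    obtain ⟨A, hA, hA'⟩ := Lipbs.exists_abs_le f
    obtain ⟨L, hL⟩ := g.2 _ f.2.2
    obtain ⟨M, hM, hM'⟩ := Liploc.exists_abs_le g f.2.2
    -- `g` need not be globally Lipschitz or bounded. Its values off the support of `f` are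
    -- irrelevant, so it is replaced by a bounded Lipschitz extension of its restriction to that
    -- support.
    obtain ⟨e, he, heq⟩ := hL.extend_real
    have he' : LipschitzWith L (fun z => max (-M) (min (e z) M)) :=
      (he.min_const M).const_max (-M)
    have hb : ∀ z, |max (-M) (min (e z) M)| ≤ M := fun z =>
      abs_le.2 ⟨le_max_left _ _, max_le (by linarith) (min_le_right _ _)⟩
    have key : (fun z => f.1 z * g.1 z) = fun z => f.1 z * max (-M) (min (e z) M) := by
      ext z
      by_cases hz : z ∈ tsupport f.1
      · have h1 := abs_le.1 (hM' z hz)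
        rw [heq hz] at h1
        rw [min_eq_left h1.2, max_eq_right h1.1, heq hz]
      · simp [Lipbs.eq_zero f hz]
    rw [key]
    exact ⟨_, lipschitzOnWith_univ.1 (lipschitzOnWith_mul (M := ⟨A, hA⟩) (N := ⟨M, hM⟩)
      hK.lipschitzOnWith he'.lipschitzOnWith (fun z _ => hA' z) (fun z _ => hb z))⟩⟩

theorem Lipbs.tsupport_mul_subset (f : Lipbs Z) (g : Liploc Z) :
    tsupport (Lipbs.mul f g).1 ⊆ tsupport f.1 := tsupport_mul_left_subset _ _

/-- The composition of a Lipschitz function that fixes zero with a Lipschitz function with bounded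
support. -/
def Lipbs.comp (f : Lipbs Z) (φ : ℝ → ℝ) (hφ : ∃ K : ℝ≥0, LipschitzWith K φ) (h0 : φ 0 = 0) :
    Lipbs Z :=
  ⟨fun z => φ (f.1 z), by
    obtain ⟨K, hK⟩ := hφ
    obtain ⟨L, hL⟩ := f.2.1
    exact ⟨⟨K * L, hK.comp hL⟩, f.2.2.subset (closure_mono fun z hz => by
      rw [Function.mem_support] at hz ⊢
      exact fun h => hz (by rw [h, h0]))⟩⟩

theorem Lipbs.tsupport_comp_subset (f : Lipbs Z) (φ : ℝ → ℝ) (hφ : ∃ K : ℝ≥0, LipschitzWith K φ)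
    (h0 : φ 0 = 0) : tsupport (Lipbs.comp f φ hφ h0).1 ⊆ tsupport f.1 :=
  closure_mono fun z hz => by
    rw [Function.mem_support] at hz ⊢
    exact fun h => hz (by change φ (f.1 z) = 0; rw [h, h0])

theorem tsupport_subset_of_isClosed {f : Z → ℝ} {A : Set Z} (hA : IsClosed A)
    (h : ∀ z, z ∉ A → f z = 0) : tsupport f ⊆ A :=
  closure_minimal (fun z hz => by_contra fun hz' => hz (h z hz')) hA

theorem exists_bump (A : Set Z) {δ : ℝ} (hδ : 0 < δ) :
    ∃ σ : Z → ℝ, (∃ K : ℝ≥0, LipschitzWith K σ) ∧ (∀ z, 0 ≤ σ z) ∧ (∀ z, σ z ≤ 1) ∧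
      (∀ z ∈ Metric.cthickening (δ / 2) A, σ z = 1) ∧ ∀ z ∉ Metric.thickening δ A, σ z = 0 := by
  rcases A.eq_empty_or_nonempty with rfl | hA
  · exact ⟨fun _ => 0, ⟨0, LipschitzWith.const 0⟩, by simp, by simp, by simp, by simp⟩
  -- At distance d from `A` the profile is 4 - 4d/δ truncated to [0, 1]: it is 1 up to 3δ/4 and 0
  -- from δ on. The margin beyond δ/2 allows passing from closed to open thickenings.
  · refine ⟨fun z => max 0 (min 1 (4 + (-4 / δ) * Metric.infDist z A)), ?_, fun z => le_max_left _ _,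
      fun z => max_le zero_le_one (min_le_left _ _), fun z hz => ?_, fun z hz => ?_⟩
    · have h1 : LipschitzWith (0 + ‖(-4 / δ : ℝ)‖₊ * 1)
          (fun z => 4 + (-4 / δ) * Metric.infDist z A) :=
        (LipschitzWith.const (4 : ℝ)).add
          ((lipschitzWith_smul (-4 / δ : ℝ)).comp (Metric.lipschitz_infDist_pt A))
      exact ⟨_, (h1.const_min 1).const_max 0⟩
    · dsimp only
      have h1 : Metric.infDist z A < 3 / 4 * δ := (Metric.mem_thickening_iff_infDist_lt hA).1
        (Metric.cthickening_subset_thickening' (by positivity) (by linarith) _ hz)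
      have h2 : (-4 / δ) * Metric.infDist z A = -(4 * Metric.infDist z A / δ) := by ring
      have h3 : 4 * Metric.infDist z A / δ ≤ 3 := by rw [div_le_iff₀ hδ]; linarith
      rw [min_eq_left (by linarith), max_eq_right zero_le_one]
    · have h1 : δ ≤ Metric.infDist z A :=
        not_lt.1 fun h => hz ((Metric.mem_thickening_iff_infDist_lt hA).2 h)
      have h2 : (-4 / δ) * Metric.infDist z A = -(4 * Metric.infDist z A / δ) := by ring
      have h3 : 4 ≤ 4 * Metric.infDist z A / δ := by rw [le_div_iff₀ hδ]; linarith
      exact max_eq_left ((min_le_right _ _).trans (by linarith))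

end

/-! ### Strict locality and the boundary operator -/

noncomputable section

variable {Z : Type*} [MetricSpace Z] {m : ℕ}

/-- The function that moves every real number by at most `ε` towards `c`. -/
def shrink (c ε x : ℝ) : ℝ := x - max (-ε) (min (x - c) ε)

theorem shrink_lipschitz (c ε : ℝ) : LipschitzWith 2 (shrink c ε) := by
  have h : LipschitzWith (1 + 0) (fun x : ℝ => x - c) :=
    LipschitzWith.id.sub (LipschitzWith.const c)
  have := LipschitzWith.id.sub ((h.min_const ε).const_max (-ε))
  rwa [show (1 : ℝ≥0) + (1 + 0) = 2 by norm_num] at this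

theorem shrink_eq {c ε x : ℝ} (h : |x - c| ≤ ε) : shrink c ε x = c := by
  have h := abs_le.1 h
  rw [shrink, min_eq_left h.2, max_eq_right h.1]
  ring

theorem abs_shrink_sub_le {c ε x : ℝ} (hε : 0 ≤ ε) : |shrink c ε x - x| ≤ ε := by
  rw [shrink, sub_sub_cancel_left, abs_neg]
  exact abs_le.2 ⟨le_max_left _ _, max_le (by linarith) (min_le_right _ _)⟩

/-- Strict locality: constancy on the support itself suffices, without a neighbourhood. Moving the
values of `π i` by at most ε towards `c` makes it equal to `c` near the support, since `π i` is
Lipschitz there. As ε → 0 the modified functions converge to `π i` with bounded local Lipschitz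
constants, so the continuity axiom applies. -/
theorem IsMetricFunctional.eq_zero_of_eq_const {T : FormFunction Z m} (hT : IsMetricFunctional T)
    {f : Lipbs Z} {π : Fin m → Liploc Z} (i : Fin m) (c : ℝ)
    (h : ∀ z ∈ tsupport f.1, (π i).1 z = c) : T f π = 0 := by
  let ε : ℕ → ℝ := fun j => 1 / ((j : ℝ) + 1)
  have hε : ∀ j, 0 < ε j := fun j => by positivity
  let p : ℕ → Liploc Z := fun j => Liploc.comp (π i) (shrink c (ε j)) ⟨2, shrink_lipschitz c _⟩
  have key : Tendsto (fun j => T f (Function.update π i (p j))) atTop (𝓝 (T f π)) := by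
    refine hT.continuous f π _ (fun k z => ?_) (fun B hB => ?_)
    · by_cases hk : k = i
      · subst hk
        simp only [Function.update_self]
        refine tendsto_iff_dist_tendsto_zero.2 (squeeze_zero (fun _ => dist_nonneg) (fun j => ?_)
          tendsto_one_div_add_atTop_nhds_zero_nat)
        rw [Real.dist_eq]
        exact abs_shrink_sub_le (hε j).le
      · simp only [Function.update_of_ne hk]
        exact tendsto_const_nhds
    · choose K hK using fun k => (π k).2 B hB
      refine ⟨∑ k, K k + 2 * ∑ k, K k, fun j k => ?_⟩
      have hle : K k ≤ ∑ k, K k := Finset.single_le_sum (f := K) (fun _ _ => zero_le) (Finset.mem_univ k)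
      by_cases hk : k = i
      · subst hk
        rw [Function.update_self]
        refine ((shrink_lipschitz c (ε j)).comp_lipschitzOnWith (hK k)).weaken ?_
        exact (mul_le_mul_right hle 2).trans le_add_self
      · rw [Function.update_of_ne hk]
        exact (hK k).weaken (hle.trans le_self_add)
  have h0 : ∀ j, T f (Function.update π i (p j)) = 0 := fun j => by
    obtain ⟨K, hK⟩ := (π i).2 _ (f.2.2.cthickening (δ := 1))
    have hd : 0 < ε j / (K + 1) := div_pos (hε j) (by positivity)
    -- Within distance `ε j / (K + 1)` of the support, `π i` differs from `c` by at most `ε j`. The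
    -- bound 1 keeps points where `K` is valid; halving leaves room to find an actual support point
    -- within the full distance.
    refine hT.local' f _ ⟨i, min (1 / 2) (ε j / (K + 1) / 2), by positivity, c, fun z hz => ?_⟩
    rw [Function.update_self]
    refine shrink_eq ?_
    have hz1 := Metric.cthickening_subset_thickening' (δ₂ := min 1 (ε j / (K + 1))) (by positivity)
      (lt_min (by linarith [min_le_left (1 / 2) (ε j / (K + 1) / 2)])
        (by linarith [min_le_right (1 / 2) (ε j / (K + 1) / 2)])) _ hz
    obtain ⟨y, hy, hyz⟩ := Metric.mem_thickening_iff.1 hz1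
    have h1 := hK.dist_le_mul z (Metric.mem_cthickening_of_dist_le z y _ _ hy
      (hyz.le.trans (min_le_left _ _))) y (Metric.self_subset_cthickening _ hy)
    rw [Real.dist_eq] at h1
    change |(π i).1 z - (π i).1 y| ≤ _ at h1
    rw [h y hy] at h1
    refine h1.trans ?_
    have h2 : dist z y ≤ ε j / (K + 1) := hyz.le.trans (min_le_right _ _)
    rw [le_div_iff₀ (by positivity)] at h2
    nlinarith [dist_nonneg (x := z) (y := y)]
  simp only [h0] at key
  exact (tendsto_nhds_unique key tendsto_const_nhds)

/-- A metric functional as a multilinear map in its last arguments. -/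
def IsMetricFunctional.toMultilinearMap {T : FormFunction Z m} (hT : IsMetricFunctional T)
    (f : Lipbs Z) : MultilinearMap ℝ (fun _ : Fin m => Liploc Z) ℝ where
  toFun := T f
  map_update_add' π i p q := by
    have := (hT.linear_right f π i).map_add p q
    convert this
  map_update_smul' π i c p := by
    have := (hT.linear_right f π i).map_smul c p
    convert this

theorem IsMetricFunctional.update_sub {T : FormFunction Z m} (hT : IsMetricFunctional T)
    (f : Lipbs Z) (π : Fin m → Liploc Z) (i : Fin m) (p q : Liploc Z) :
    T f (Function.update π i (p - q)) = T f (Function.update π i p) - T f (Function.update π i q) :=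
  (hT.linear_right f π i).map_sub p q

/-- Replace the components one at a time; each difference vanishes on the support of `f`, so strict
locality applies. -/
theorem IsMetricFunctional.congr_right {T : FormFunction Z m} (hT : IsMetricFunctional T)
    {f : Lipbs Z} {π π' : Fin m → Liploc Z}
    (h : ∀ i, ∀ z ∈ tsupport f.1, (π i).1 z = (π' i).1 z) : T f π = T f π' := by
  classical
  have key : ∀ s : Finset (Fin m), T f (s.piecewise π' π) = T f π := by
    intro s
    induction s using Finset.induction_on with
    | empty => simp
    | insert i s hi ih =>
      rw [Finset.piecewise_insert, ← ih]
      have h1 : T f (Function.update (s.piecewise π' π) i (π' i)) -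
          T f (Function.update (s.piecewise π' π) i (π i)) = 0 := by
        rw [← hT.update_sub]
        refine hT.eq_zero_of_eq_const i 0 fun z hz => ?_
        rw [Function.update_self]
        exact sub_eq_zero.2 (h i z hz).symm
      rw [sub_eq_zero.1 h1]
      congr 1
      rw [Function.update_eq_self_iff, Finset.piecewise_eq_of_notMem _ _ _ hi]
  have := key Finset.univ
  rw [Finset.piecewise_univ] at this
  exact this.symm

theorem IsMetricFunctional.sub_left {T : FormFunction Z m} (hT : IsMetricFunctional T)
    (f g : Lipbs Z) (π : Fin m → Liploc Z) : T (f - g) π = T f π - T g π :=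
  (hT.linear_left π).map_sub f g

theorem IsMetricFunctional.add_left {T : FormFunction Z m} (hT : IsMetricFunctional T)
    (f g : Lipbs Z) (π : Fin m → Liploc Z) : T (f + g) π = T f π + T g π :=
  (hT.linear_left π).map_add f g

theorem IsMetricFunctional.smul_left {T : FormFunction Z m} (hT : IsMetricFunctional T)
    (c : ℝ) (f : Lipbs Z) (π : Fin m → Liploc Z) : T (c • f) π = c * T f π :=
  (hT.linear_left π).map_smul c f

theorem IsMetricFunctional.neg_left {T : FormFunction Z m} (hT : IsMetricFunctional T)
    (f : Lipbs Z) (π : Fin m → Liploc Z) : T (-f) π = -T f π :=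
  (hT.linear_left π).map_neg f

theorem IsMetricFunctional.zero_left {T : FormFunction Z m} (hT : IsMetricFunctional T)
    (π : Fin m → Liploc Z) : T 0 π = 0 :=
  (hT.linear_left π).map_zero

theorem IsMetricFunctional.isLinearMap_cons {T : FormFunction Z (m + 1)}
    (hT : IsMetricFunctional T) (f : Lipbs Z) (π : Fin m → Liploc Z) :
    IsLinearMap ℝ fun p : Liploc Z => T f (Fin.cons p π) := by
  have := hT.linear_right f (Fin.cons 0 π) 0
  simpa only [Fin.update_cons_zero] using this

theorem cutoff_eq_one (f : Lipbs Z) {z : Z} (hz : z ∈ tsupport f.1) : (cutoff f).1 z = 1 :=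
  (exists_cutoff f).choose_spec z hz

/-- The boundary does not depend on the choice of the cutoff function. -/
theorem IsMetricFunctional.congr_cutoff {T : FormFunction Z (m + 1)} (hT : IsMetricFunctional T)
    {f σ τ : Lipbs Z} (h : ∀ z ∈ tsupport f.1, σ.1 z = τ.1 z) (π : Fin m → Liploc Z) :
    T σ (Fin.cons (Lipbs.toLiploc f) π) = T τ (Fin.cons (Lipbs.toLiploc f) π) := by
  rw [← sub_eq_zero, ← hT.sub_left]
  -- `σ - τ` can be nonzero only off the support of `f`, so its closed support lies in the zero set
  -- of `f`, where the first component `f` is constant.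
  refine hT.eq_zero_of_eq_const 0 0 fun z hz => ?_
  have hcl : IsClosed {z | f.1 z = 0} := isClosed_eq (Lipbs.continuous f) continuous_const
  have : tsupport (σ - τ).1 ⊆ {z | f.1 z = 0} :=
    tsupport_subset_of_isClosed hcl fun z hz => sub_eq_zero.2 (h z (subset_tsupport _ hz))
  exact this hz

theorem IsMetricFunctional.boundary_eq {T : FormFunction Z (m + 1)} (hT : IsMetricFunctional T)
    {f σ : Lipbs Z} (h : ∀ z ∈ tsupport f.1, σ.1 z = 1) (π : Fin m → Liploc Z) :
    boundary T f π = T σ (Fin.cons (Lipbs.toLiploc f) π) :=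
  hT.congr_cutoff (fun z hz => by rw [cutoff_eq_one f hz, h z hz]) π

/-- Cutoff functions with support near a bounded set. -/
theorem exists_lipbs_bump {A : Set Z} (hA : Bornology.IsBounded A) {δ : ℝ} (hδ : 0 < δ) :
    ∃ σ : Lipbs Z, (∀ z ∈ Metric.cthickening (δ / 2) A, σ.1 z = 1) ∧
      tsupport σ.1 ⊆ Metric.cthickening δ A := by
  obtain ⟨σ, hσ, -, -, h1, h2⟩ := exists_bump A hδ
  have hsub : tsupport σ ⊆ Metric.cthickening δ A :=
    tsupport_subset_of_isClosed Metric.isClosed_cthickening fun z hz =>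
      h2 z fun hz' => hz (Metric.thickening_subset_cthickening _ _ hz')
  exact ⟨⟨σ, hσ, hA.cthickening.subset hsub⟩, h1, hsub⟩

theorem IsMetricFunctional.boundary {T : FormFunction Z (m + 1)} (hT : IsMetricFunctional T) :
    IsMetricFunctional (boundary T) where
  linear_left π := by
    have key : ∀ (a b : ℝ) (f g : Lipbs Z), MetricCurrent.boundary T (a • f + b • g) π =
        a * MetricCurrent.boundary T f π + b * MetricCurrent.boundary T g π := by
      intro a b f g
      obtain ⟨σ, hσ, -⟩ := exists_lipbs_bump (f.2.2.union g.2.2) one_pos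
      have hσ' : ∀ z ∈ tsupport f.1 ∪ tsupport g.1, σ.1 z = 1 := fun z hz =>
        hσ z (Metric.self_subset_cthickening _ hz)
      have hs : tsupport (a • f + b • g).1 ⊆ tsupport f.1 ∪ tsupport g.1 :=
        (tsupport_add (a • f.1) (b • g.1)).trans (union_subset_union
          (closure_mono (Function.support_const_smul_subset a f.1))
          (closure_mono (Function.support_const_smul_subset b g.1)))
      rw [hT.boundary_eq (fun z hz => hσ' z (hs hz)), hT.boundary_eq (fun z hz => hσ' z (.inl hz)),
        hT.boundary_eq (fun z hz => hσ' z (.inr hz))]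
      have h := hT.isLinearMap_cons σ π
      rw [← smul_eq_mul, ← smul_eq_mul, ← h.map_smul, ← h.map_smul, ← h.map_add]
      rfl
    refine ⟨fun f g => ?_, fun a f => ?_⟩
    · simpa using key 1 1 f g
    · simpa using key a 0 f 0
  linear_right f π i := by
    have := hT.linear_right (cutoff f) (Fin.cons (Lipbs.toLiploc f) π) i.succ
    simp only [← Fin.cons_update] at this
    exact this
  continuous f π πs h1 h2 := by
    refine hT.continuous _ _ _ (fun i z => ?_) (fun B hB => ?_)
    · refine Fin.cases ?_ (fun i => ?_) i
      · simp
      · simpa using h1 i z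
    · obtain ⟨K, hK⟩ := h2 B hB
      obtain ⟨L, hL⟩ := (Lipbs.toLiploc f).2 B hB
      refine ⟨K + L, fun j i => ?_⟩
      refine Fin.cases ?_ (fun i => ?_) i
      · simpa using hL.weaken le_add_self
      · simpa using (hK j i).weaken le_self_add
  local' f π := by
    rintro ⟨i, δ, hδ, c, h⟩
    obtain ⟨σ, hσ, hσ'⟩ := exists_lipbs_bump f.2.2 hδ
    rw [hT.boundary_eq (σ := σ) fun z hz => hσ z (Metric.self_subset_cthickening _ hz)]
    exact hT.eq_zero_of_eq_const i.succ c fun z hz => by simpa using h z (hσ' hz)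

/-- The double boundary is T(σ', σ, f, π) with σ = 1 near the support of `f`. The outer cutoff σ'
may be exchanged for a function τ supported so close to the support of `f` that σ = 1 on the support
of τ; then strict locality in the component σ gives zero. -/
theorem IsMetricFunctional.boundary_boundary {T : FormFunction Z (m + 2)}
    (hT : IsMetricFunctional T) : MetricCurrent.boundary (MetricCurrent.boundary T) = 0 := by
  ext f π
  obtain ⟨σ, hσ, -⟩ := exists_lipbs_bump f.2.2 one_pos
  obtain ⟨τ, hτ, hτ'⟩ := exists_lipbs_bump f.2.2 (half_pos (half_pos one_pos))
  have h1 : ∀ z ∈ tsupport f.1, σ.1 z = 1 := fun z hz => hσ z (Metric.self_subset_cthickening _ hz)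
  rw [hT.boundary.boundary_eq h1, hT.boundary_eq (fun z hz => cutoff_eq_one σ hz)]
  have h2 : T (cutoff σ) (Fin.cons (Lipbs.toLiploc σ) (Fin.cons (Lipbs.toLiploc f) π)) =
      T τ (Fin.cons (Lipbs.toLiploc σ) (Fin.cons (Lipbs.toLiploc f) π)) := by
    rw [← sub_eq_zero, ← hT.sub_left]
    refine hT.eq_zero_of_eq_const 1 0 fun z hz => ?_
    have hcl : IsClosed {z | f.1 z = 0} := isClosed_eq (Lipbs.continuous f) continuous_const
    refine (tsupport_subset_of_isClosed hcl fun z hz => ?_ : tsupport (cutoff σ - τ).1 ⊆ _) hz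
    have hz' : z ∈ tsupport f.1 := subset_tsupport _ hz
    have h3 : (cutoff σ).1 z = 1 := by
      refine cutoff_eq_one σ (subset_tsupport _ ?_)
      rw [Function.mem_support, h1 z hz']
      exact one_ne_zero
    have h4 : τ.1 z = 1 := hτ z (Metric.self_subset_cthickening _ hz')
    exact sub_eq_zero.2 (h3.trans h4.symm)
  rw [h2]
  refine hT.eq_zero_of_eq_const 0 1 fun z hz => ?_
  exact hσ z (Metric.cthickening_mono (by norm_num) _ (hτ' hz))

end

/-! ### The mass as a Borel measure -/

noncomputable section

variable {Z : Type*} [MetricSpace Z] {m : ℕ}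

theorem IsMassFamily.le_massIn {n : ℕ} {T : FormFunction Z m} {V : Set Z} {f : Fin n → Lipbs Z}
    {π : Fin n → Fin m → Liploc Z} (h : IsMassFamily V f π) :
    ENNReal.ofReal (∑ l, T (f l) (π l)) ≤ massIn T V :=
  le_iSup_of_le n <| le_iSup_of_le f <| le_iSup_of_le π <| le_iSup_of_le h le_rfl

theorem massIn_le {T : FormFunction Z m} {V : Set Z} {c : ℝ≥0∞}
    (h : ∀ (n : ℕ) (f : Fin n → Lipbs Z) (π : Fin n → Fin m → Liploc Z), IsMassFamily V f π →
      ENNReal.ofReal (∑ l, T (f l) (π l)) ≤ c) : massIn T V ≤ c :=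
  iSup_le fun n => iSup_le fun f => iSup_le fun π => iSup_le fun hf => h n f π hf

theorem massIn_mono (T : FormFunction Z m) {V W : Set Z} (h : V ⊆ W) : massIn T V ≤ massIn T W :=
  massIn_le fun _ _ _ hf =>
    IsMassFamily.le_massIn ⟨hf.lipschitz, fun l => (hf.support_subset l).trans h, hf.sum_le_one⟩

theorem mass_mono (T : FormFunction Z m) {A B : Set Z} (h : A ⊆ B) : mass T A ≤ mass T B :=
  le_iInf fun V => le_iInf fun hV => le_iInf fun hB =>
    iInf_le_of_le V <| iInf_le_of_le hV <| iInf_le_of_le (h.trans hB) le_rfl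

theorem mass_le_massIn (T : FormFunction Z m) {A V : Set Z} (hV : IsOpen V) (h : A ⊆ V) :
    mass T A ≤ massIn T V :=
  iInf_le_of_le V <| iInf_le_of_le hV <| iInf_le_of_le h le_rfl

theorem mass_of_isOpen (T : FormFunction Z m) {V : Set Z} (hV : IsOpen V) :
    mass T V = massIn T V :=
  le_antisymm (mass_le_massIn T hV Subset.rfl)
    (le_iInf fun _ => le_iInf fun _ => le_iInf fun h => massIn_mono T h)

theorem exists_isOpen_massIn_lt {T : FormFunction Z m} {A : Set Z} {c : ℝ≥0∞} (h : mass T A < c) :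
    ∃ V, IsOpen V ∧ A ⊆ V ∧ massIn T V < c := by
  simp only [mass, iInf_lt_iff] at h
  obtain ⟨V, hV, hA, h⟩ := h
  exact ⟨V, hV, hA, h⟩

theorem IsMetricFunctional.massIn_empty {T : FormFunction Z m} (hT : IsMetricFunctional T) :
    massIn T ∅ = 0 := by
  refine le_antisymm (massIn_le fun n f π hf => ?_) zero_le
  have : ∀ l, f l = 0 := fun l =>
    Subtype.ext (tsupport_eq_empty_iff.1 (subset_empty_iff.1 (hf.support_subset l)))
  simp [this, hT.zero_left]

/-- Cutting off near a compact set. -/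
theorem IsMetricFunctional.massIn_le_add {T : FormFunction Z m} (hT : IsMetricFunctional T)
    {K V W : Set Z} (hK : IsCompact K) (hW : IsOpen W) (hKW : K ⊆ W) :
    massIn T V ≤ massIn T (V ∩ W) + massIn T (V \ K) := by
  refine massIn_le fun n f π hf => ?_
  obtain ⟨δ, hδ, hδW⟩ := hK.exists_cthickening_subset_open hW hKW
  -- Split each `f l` as `f l * σ + f l * (1 - σ)`, where σ is supported in `W` and equals 1 near
  -- `K`: the first parts are admissible in `V ∩ W`, the second in `V \ K`.
  obtain ⟨σ, hσ, h0, h1, hσ1, hσ0⟩ := exists_bump K hδ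
  have hσ' : ∃ K : ℝ≥0, LipschitzWith K fun z => 1 - σ z := by
    obtain ⟨L, hL⟩ := hσ
    exact ⟨0 + L, (LipschitzWith.const (1 : ℝ)).sub hL⟩
  let s : Liploc Z := Liploc.ofLipschitz σ hσ
  let t : Liploc Z := Liploc.ofLipschitz _ hσ'
  have hsum : ∀ l, f l = Lipbs.mul (f l) s + Lipbs.mul (f l) t := fun l => by
    ext z
    change (f l).1 z = (f l).1 z * σ z + (f l).1 z * (1 - σ z)
    ring
  have hs : IsMassFamily (V ∩ W) (fun l => Lipbs.mul (f l) s) π := by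
    refine ⟨hf.lipschitz, fun l => subset_inter
      ((Lipbs.tsupport_mul_subset _ _).trans (hf.support_subset l)) ?_, fun z => ?_⟩
    · refine (tsupport_subset_of_isClosed Metric.isClosed_cthickening fun z hz => ?_).trans hδW
      change (f l).1 z * σ z = 0
      rw [hσ0 z fun h => hz (Metric.thickening_subset_cthickening _ _ h), mul_zero]
    · refine (Finset.sum_le_sum fun l _ => ?_).trans (hf.sum_le_one z)
      change |(f l).1 z * σ z| ≤ _
      rw [abs_mul, abs_of_nonneg (h0 z)]
      exact mul_le_of_le_one_right (abs_nonneg _) (h1 z)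
  have ht : IsMassFamily (V \ K) (fun l => Lipbs.mul (f l) t) π := by
    refine ⟨hf.lipschitz, fun l => ?_, fun z => ?_⟩
    · refine fun z hz => ⟨hf.support_subset l (Lipbs.tsupport_mul_subset _ _ hz), fun hzK => ?_⟩
      have : tsupport (Lipbs.mul (f l) t).1 ⊆ (Metric.thickening (δ / 2) K)ᶜ := by
        refine tsupport_subset_of_isClosed Metric.isOpen_thickening.isClosed_compl fun z hz => ?_
        change (f l).1 z * (1 - σ z) = 0
        rw [hσ1 z (Metric.thickening_subset_cthickening _ _ (notMem_compl_iff.1 hz)), sub_self,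
          mul_zero]
      exact this hz (Metric.self_subset_thickening (half_pos hδ) _ hzK)
    · refine (Finset.sum_le_sum fun l _ => ?_).trans (hf.sum_le_one z)
      change |(f l).1 z * (1 - σ z)| ≤ _
      rw [abs_mul, abs_of_nonneg (sub_nonneg.2 (h1 z))]
      exact mul_le_of_le_one_right (abs_nonneg _) (by linarith [h0 z])
  calc ENNReal.ofReal (∑ l, T (f l) (π l))
      = ENNReal.ofReal (∑ l, T (Lipbs.mul (f l) s) (π l) + ∑ l, T (Lipbs.mul (f l) t) (π l)) := by
        rw [← Finset.sum_add_distrib]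
        congr 2 with l
        rw [← hT.add_left, ← hsum]
    _ ≤ _ := ENNReal.ofReal_add_le
    _ ≤ _ := add_le_add hs.le_massIn ht.le_massIn

theorem massIn_add_le {T : FormFunction Z m} {V W : Set Z} {c : ℝ≥0∞}
    (h : ∀ (n : ℕ) (f : Fin n → Lipbs Z) (π : Fin n → Fin m → Liploc Z), IsMassFamily V f π →
      ∀ (k : ℕ) (g : Fin k → Lipbs Z) (χ : Fin k → Fin m → Liploc Z), IsMassFamily W g χ →
      ENNReal.ofReal (∑ l, T (f l) (π l)) + ENNReal.ofReal (∑ l, T (g l) (χ l)) ≤ c) :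
    massIn T V + massIn T W ≤ c := by
  have h1 : ∀ (n : ℕ) (f : Fin n → Lipbs Z) (π : Fin n → Fin m → Liploc Z), IsMassFamily V f π →
      ENNReal.ofReal (∑ l, T (f l) (π l)) + massIn T W ≤ c := fun n f π hf => by
    have hc : ENNReal.ofReal (∑ l, T (f l) (π l)) ≤ c := by
      have := h n f π hf 0 (fun _ => 0) (fun _ _ => 0)
        ⟨fun l => l.elim0, fun l => l.elim0, fun z => by simp⟩
      exact le_self_add.trans this
    have h2 : massIn T W ≤ c - ENNReal.ofReal (∑ l, T (f l) (π l)) := massIn_le fun k g χ hg =>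
      ENNReal.le_sub_of_add_le_left ENNReal.ofReal_ne_top (h n f π hf k g χ hg)
    exact (add_le_add_right h2 _).trans (add_tsub_cancel_of_le hc).le
  have hW : massIn T W ≤ c := by
    have := h1 0 (fun _ => 0) (fun _ _ => 0) ⟨fun l => l.elim0, fun l => l.elim0, fun z => by simp⟩
    exact le_add_self.trans this
  rcases eq_or_ne (massIn T W) ∞ with h3 | h3
  · rw [h3, top_le_iff] at hW
    simp [hW]
  · have h2 : massIn T V ≤ c - massIn T W := massIn_le fun k g χ hg =>
      ENNReal.le_sub_of_add_le_right h3 (h1 k g χ hg)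
    exact (add_le_add_left h2 _).trans (tsub_add_cancel_of_le hW).le

theorem massIn_add_le_of_disjoint (T : FormFunction Z m) {V W : Set Z} (hVW : Disjoint V W) :
    massIn T V + massIn T W ≤ massIn T (V ∪ W) := by
  refine massIn_add_le fun n f π hf k g χ hg => ?_
  -- A negative sum is truncated to 0 by `ENNReal.ofReal`, and the other family alone suffices.
  -- Otherwise the two families are concatenated, which disjointness permits.
  rcases le_total 0 (∑ l, T (f l) (π l)) with h1 | h1
  swap
  · rw [ENNReal.ofReal_of_nonpos h1, zero_add]
    exact hg.le_massIn.trans (massIn_mono T subset_union_right)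
  rcases le_total 0 (∑ l, T (g l) (χ l)) with h2 | h2
  swap
  · rw [ENNReal.ofReal_of_nonpos h2, add_zero]
    exact hf.le_massIn.trans (massIn_mono T subset_union_left)
  rw [← ENNReal.ofReal_add h1 h2]
  have key : IsMassFamily (V ∪ W) (Fin.append f g) (Fin.append π χ) := by
    refine ⟨fun l => ?_, fun l => ?_, fun z => ?_⟩
    · refine Fin.addCases (fun l => ?_) (fun l => ?_) l
      · simpa using hf.lipschitz l
      · simpa using hg.lipschitz l
    · refine Fin.addCases (fun l => ?_) (fun l => ?_) l
      · simpa using (hf.support_subset l).trans subset_union_left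
      · simpa using (hg.support_subset l).trans subset_union_right
    · simp only [Fin.sum_univ_add, Fin.append_left, Fin.append_right]
      by_cases hz : z ∈ V
      · have : ∀ l, (g l).1 z = 0 := fun l => Lipbs.eq_zero _ fun h =>
          disjoint_left.1 hVW hz (hg.support_subset l h)
        simpa [this] using hf.sum_le_one z
      · have : ∀ l, (f l).1 z = 0 := fun l => Lipbs.eq_zero _ fun h => hz (hf.support_subset l h)
        simpa [this] using hg.sum_le_one z
  have := key.le_massIn (T := T)
  simpa only [Fin.sum_univ_add, Fin.append_left, Fin.append_right] using this

/-- Metric functionals whose mass in bounded open sets is finite and concentrated, up to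
arbitrarily little, on compact sets (not required to be contained in the open set). -/
structure IsTight (T : FormFunction Z m) : Prop where
  isMetricFunctional : IsMetricFunctional T
  tight : ∀ U : Set Z, IsOpen U → Bornology.IsBounded U → ∀ ε : ℝ≥0∞, 0 < ε →
    ∃ C : Set Z, IsCompact C ∧ massIn T U < ∞ ∧ massIn T (U \ C) < ε

theorem IsLocallyFiniteMass.isTight {T : FormFunction Z m} (hT : IsLocallyFiniteMass T) :
    IsTight T :=
  ⟨hT.1, fun U hU hB ε hε => by
    obtain ⟨C, h1, -, h2⟩ := hT.2 U hU hB ε hε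
    exact ⟨C, h1, h2⟩⟩

/-- Tightness takes the place of separability. Up to ε, the mass on the closed support `S` of a
family sits on a compact part of `S`. This part is covered by finitely many `V i` and splits into
compact `K i ⊆ V i`, which are cut off one after another. -/
theorem IsTight.massIn_iUnion_le {T : FormFunction Z m} (hT : IsTight T) {V : ℕ → Set Z}
    (hV : ∀ i, IsOpen (V i)) : massIn T (⋃ i, V i) ≤ ∑' i, massIn T (V i) := by
  refine massIn_le fun n f π hf => ENNReal.le_of_forall_pos_le_add fun ε hε _ => ?_
  set S : Set Z := ⋃ l, tsupport (f l).1 with hS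
  have hSb : Bornology.IsBounded S := Bornology.isBounded_iUnion.2 fun l => (f l).2.2
  have hSc : IsClosed S := isClosed_iUnion_of_finite fun l => isClosed_tsupport _
  have hSV : S ⊆ ⋃ i, V i := iUnion_subset hf.support_subset
  have hfS : IsMassFamily S f π :=
    ⟨hf.lipschitz, fun l => subset_iUnion (fun l => tsupport (f l).1) l, hf.sum_le_one⟩
  obtain ⟨C, hC, -, hCε⟩ := hT.tight (Metric.thickening 1 S) Metric.isOpen_thickening
    (hSb.thickening) ε (by exact_mod_cast hε)
  obtain ⟨t, ht⟩ := (hC.inter_right hSc).elim_finite_subcover V hV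
    (inter_subset_right.trans hSV)
  obtain ⟨K, hK, hKV, hKu⟩ :=
    (hC.inter_right hSc).finite_compact_cover t V (fun i _ => hV i) ht
  have key : ∀ s : Finset ℕ, massIn T S ≤ ∑ i ∈ s, massIn T (V i) +
      massIn T (S \ ⋃ i ∈ s, K i) := by
    intro s
    induction s using Finset.induction_on with
    | empty => simp
    | insert i s hi ih =>
      refine ih.trans ?_
      rw [Finset.sum_insert hi, add_comm (massIn T (V i)), add_assoc]
      refine add_le_add_right ((hT.1.massIn_le_add (hK i) (hV i) (hKV i)).trans
        (add_le_add (massIn_mono T inter_subset_right) (massIn_mono T ?_))) _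
      intro z hz
      refine ⟨hz.1.1, ?_⟩
      simp only [Finset.mem_insert, iUnion_iUnion_eq_or_left, mem_union, not_or]
      exact ⟨hz.2, hz.1.2⟩
  calc ENNReal.ofReal (∑ l, T (f l) (π l)) ≤ massIn T S := hfS.le_massIn
    _ ≤ ∑ i ∈ t, massIn T (V i) + massIn T (S \ ⋃ i ∈ t, K i) := key t
    _ ≤ _ := by
      refine add_le_add (ENNReal.sum_le_tsum t) ((massIn_mono T ?_).trans hCε.le)
      rw [← hKu]
      exact fun z hz => ⟨Metric.self_subset_thickening one_pos _ hz.1,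
        fun h => hz.2 ⟨h, hz.1⟩⟩

/-- The outer measure `‖T‖`. -/
def IsTight.massOuterMeasure {T : FormFunction Z m} (hT : IsTight T) : OuterMeasure Z where
  measureOf := mass T
  empty := le_antisymm ((mass_le_massIn T isOpen_empty Subset.rfl).trans
    hT.1.massIn_empty.le) zero_le
  mono h := mass_mono T h
  iUnion_nat A _ := by
    refine ENNReal.le_of_forall_pos_le_add fun ε hε htop => ?_
    obtain ⟨δ, hδ, hδε⟩ := ENNReal.exists_pos_sum_of_countable (ε := ε)
      (by exact_mod_cast hε.ne') ℕ
    have h1 : ∀ i, ∃ V, IsOpen V ∧ A i ⊆ V ∧ massIn T V < mass T (A i) + δ i := fun i =>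
      exists_isOpen_massIn_lt (ENNReal.lt_add_right
        (ENNReal.ne_top_of_tsum_ne_top htop.ne i) (by exact_mod_cast (hδ i).ne'))
    choose V hV hAV hlt using h1
    calc mass T (⋃ i, A i) ≤ massIn T (⋃ i, V i) :=
          mass_le_massIn T (isOpen_iUnion hV) (iUnion_mono hAV)
      _ ≤ ∑' i, massIn T (V i) := hT.massIn_iUnion_le hV
      _ ≤ ∑' i, (mass T (A i) + δ i) := ENNReal.tsum_le_tsum fun i => (hlt i).le
      _ = ∑' i, mass T (A i) + ∑' i, (δ i : ℝ≥0∞) := ENNReal.tsum_add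
      _ ≤ _ := add_le_add_right hδε.le _

/-- Two sets at positive distance lie in disjoint open sets, namely the points strictly nearer to
one than to the other, and mass is superadditive on these. Carathéodory's criterion for metric outer
measures then makes Borel sets measurable. -/
theorem IsTight.isMetric_massOuterMeasure {T : FormFunction Z m} (hT : IsTight T) :
    hT.massOuterMeasure.IsMetric := by
  rintro s t ⟨r, hr, hst⟩
  refine le_antisymm (measure_union_le s t) ?_
  change mass T s + mass T t ≤ mass T (s ∪ t)
  refine le_iInf fun V => le_iInf fun hV => le_iInf fun hstV => ?_
  let Vs : Set Z := {z | Metric.infEDist z s < Metric.infEDist z t}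
  let Vt : Set Z := {z | Metric.infEDist z t < Metric.infEDist z s}
  have hVs : IsOpen Vs := isOpen_lt Metric.continuous_infEDist Metric.continuous_infEDist
  have hVt : IsOpen Vt := isOpen_lt Metric.continuous_infEDist Metric.continuous_infEDist
  have hsVs : s ⊆ Vs := fun z hz => by
    change Metric.infEDist z s < Metric.infEDist z t
    rw [Metric.infEDist_zero_of_mem hz]
    exact (pos_iff_ne_zero.2 hr).trans_le (Metric.le_infEDist.2 fun y hy => hst z hz y hy)
  have htVt : t ⊆ Vt := fun z hz => by
    change Metric.infEDist z t < Metric.infEDist z s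
    rw [Metric.infEDist_zero_of_mem hz]
    exact (pos_iff_ne_zero.2 hr).trans_le (Metric.le_infEDist.2 fun y hy => by
      rw [edist_comm]; exact hst y hy z hz)
  have hdisj : Disjoint (V ∩ Vs) (V ∩ Vt) :=
    disjoint_left.2 fun z h1 h2 => lt_asymm (show Metric.infEDist z s < _ from h1.2) h2.2
  calc mass T s + mass T t ≤ massIn T (V ∩ Vs) + massIn T (V ∩ Vt) :=
        add_le_add (mass_le_massIn T (hV.inter hVs)
            (subset_inter (subset_union_left.trans hstV) hsVs))
          (mass_le_massIn T (hV.inter hVt) (subset_inter (subset_union_right.trans hstV) htVt))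
    _ ≤ massIn T (V ∩ Vs ∪ V ∩ Vt) := massIn_add_le_of_disjoint T hdisj
    _ ≤ massIn T V := massIn_mono T (union_subset inter_subset_left inter_subset_left)

variable [MeasurableSpace Z] [BorelSpace Z]

theorem IsTight.massMeasure_apply {T : FormFunction Z m} (hT : IsTight T) {B : Set Z}
    (hB : MeasurableSet B) : massMeasure T B = mass T B := by
  have h : ∃ μ : Measure Z, ∀ B : Set Z, MeasurableSet B → μ B = mass T B := by
    refine ⟨hT.massOuterMeasure.toMeasure ?_, fun B hB => ?_⟩
    · rw [BorelSpace.measurable_eq (α := Z)]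
      exact hT.isMetric_massOuterMeasure.borel_le_caratheodory
    · rw [toMeasure_apply _ _ hB]
      rfl
  rw [massMeasure, dif_pos h]
  exact h.choose_spec B hB

theorem IsTight.massMeasure_of_isOpen {T : FormFunction Z m} (hT : IsTight T) {V : Set Z}
    (hV : IsOpen V) : massMeasure T V = massIn T V := by
  rw [hT.massMeasure_apply hV.measurableSet, mass_of_isOpen T hV]

theorem IsTight.massMeasure_lt_top {T : FormFunction Z m} (hT : IsTight T) {B : Set Z}
    (hB : Bornology.IsBounded B) : massMeasure T B < ∞ := by
  refine (measure_mono (Metric.self_subset_thickening one_pos B)).trans_lt ?_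
  rw [hT.massMeasure_of_isOpen Metric.isOpen_thickening]
  obtain ⟨-, -, h, -⟩ := hT.tight _ Metric.isOpen_thickening (hB.thickening (δ := 1)) 1 one_pos
  exact h

/-- Exhaust `U` by increasing closed sets `F j`. The compact sets `C ∩ F j` lie in `U`, and `U \ (C
∩ F j)` decreases to `U \ C`, so continuity from above applies. Dropping `C ⊆ U` in `IsTight` lets a
compact set chosen for a large `U` serve all smaller open sets. -/
theorem IsTight.isLocallyFiniteMass {T : FormFunction Z m} (hT : IsTight T) :
    IsLocallyFiniteMass T := by
  refine ⟨hT.1, fun U hU hB ε hε => ?_⟩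
  obtain ⟨C, hC, hfin, hlt⟩ := hT.tight U hU hB ε hε
  obtain ⟨F, hF, hFU, hFu, hmono⟩ := hU.exists_iUnion_isClosed
  have hopen : ∀ j, IsOpen (U \ (C ∩ F j)) := fun j => hU.sdiff (hC.isClosed.inter (hF j))
  have hanti : Antitone fun j => U \ (C ∩ F j) := fun i j hij =>
    sdiff_subset_sdiff_right (inter_subset_inter_right _ (hmono hij))
  have hlim : Tendsto (fun j => massMeasure T (U \ (C ∩ F j))) atTop
      (𝓝 (massMeasure T (⋂ j, U \ (C ∩ F j)))) :=
    tendsto_measure_iInter_atTop (fun j => (hopen j).measurableSet.nullMeasurableSet) hanti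
      ⟨0, (hT.massMeasure_lt_top (hB.subset sdiff_subset)).ne⟩
  have hsub : ⋂ j, U \ (C ∩ F j) ⊆ U \ C := fun z hz => by
    rw [mem_iInter] at hz
    refine ⟨(hz 0).1, fun hzC => ?_⟩
    have hzU := (hz 0).1
    rw [← hFu, mem_iUnion] at hzU
    obtain ⟨j, hj⟩ := hzU
    exact (hz j).2 ⟨hzC, hj⟩
  have hlt' : massMeasure T (⋂ j, U \ (C ∩ F j)) < ε := by
    refine (measure_mono hsub).trans_lt ?_
    rwa [hT.massMeasure_of_isOpen (hU.sdiff hC.isClosed)]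
  obtain ⟨j, hj⟩ := (hlim.eventually (gt_mem_nhds hlt')).exists
  refine ⟨C ∩ F j, hC.inter_right (hF j), inter_subset_right.trans (hFU j), hfin, ?_⟩
  rwa [← hT.massMeasure_of_isOpen (hopen j)]

/-- An exhaustion by bounded open sets. -/
theorem exists_exhaustion (Z : Type*) [MetricSpace Z] : ∃ U : ℕ → Set Z, Monotone U ∧
    (∀ n, IsOpen (U n)) ∧ (∀ n, Bornology.IsBounded (U n)) ∧ (⋃ n, U n = univ) ∧
    ∀ B, Bornology.IsBounded B → ∃ n, B ⊆ U n := by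
  rcases isEmpty_or_nonempty Z with h | ⟨⟨z⟩⟩
  · exact ⟨fun _ => ∅, monotone_const, fun _ => isOpen_empty, fun _ => Bornology.isBounded_empty,
      Subsingleton.elim _ _, fun B _ => ⟨0, fun x => h.elim x⟩⟩
  · refine ⟨fun n => Metric.ball z n, fun i j hij => Metric.ball_subset_ball (by exact_mod_cast hij),
      fun n => Metric.isOpen_ball, fun n => Metric.isBounded_ball, Metric.iUnion_ball_nat z,
      fun B hB => ?_⟩
    obtain ⟨r, hr⟩ := hB.subset_ball z
    obtain ⟨n, hn⟩ := exists_nat_ge r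
    exact ⟨n, hr.trans (Metric.ball_subset_ball hn)⟩

theorem IsTight.sigmaFinite {T : FormFunction Z m} (hT : IsTight T) :
    SigmaFinite (massMeasure T) := by
  obtain ⟨U, -, -, hb, hu, -⟩ := exists_exhaustion Z
  exact ⟨⟨⟨U, fun _ => trivial, fun n => hT.massMeasure_lt_top (hb n), hu⟩⟩⟩

end

/-! ### The integral mass estimate -/

noncomputable section

variable {Z : Type*} [MetricSpace Z] {m : ℕ}

theorem Liploc.continuous (g : Liploc Z) : Continuous g.1 := by
  refine continuous_iff_continuousAt.2 fun z => ?_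
  obtain ⟨K, hK⟩ := g.2 _ (Metric.isBounded_ball (x := z) (r := 1))
  exact hK.continuousOn.continuousAt (Metric.ball_mem_nhds z one_pos)

theorem enorm_le_massIn {T : FormFunction Z m} (hT : IsMetricFunctional T) {f : Lipbs Z}
    {π : Fin m → Liploc Z} {V : Set Z} (hfV : tsupport f.1 ⊆ V) (hf : ∀ z, |f.1 z| ≤ 1)
    (hπ : ∀ i, LipschitzWith 1 (π i).1) : ‖T f π‖ₑ ≤ massIn T V := by
  have key : ∀ g : Lipbs Z, tsupport g.1 ⊆ V → (∀ z, |g.1 z| ≤ 1) →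
      ENNReal.ofReal (T g π) ≤ massIn T V := fun g hgV hg => by
    have : IsMassFamily V (fun _ : Fin 1 => g) (fun _ => π) :=
      ⟨fun _ => hπ, fun _ => hgV, fun z => by simpa using hg z⟩
    simpa using this.le_massIn (T := T)
  rw [Real.enorm_eq_ofReal_abs]
  rcases abs_choice (T f π) with h | h
  · rw [h]
    exact key f hfV hf
  · rw [h, ← hT.neg_left]
    refine key (-f) ?_ fun z => ?_
    · have : tsupport (-f).1 = tsupport f.1 := by
        change tsupport (-f.1) = _
        rw [tsupport, tsupport, Function.support_neg]
      rwa [this]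
    · change |-f.1 z| ≤ 1
      rw [abs_neg]
      exact hf z

theorem enorm_le_mul_massIn {T : FormFunction Z m} (hT : IsMetricFunctional T) {f : Lipbs Z}
    {π : Fin m → Liploc Z} {V : Set Z} (hfV : tsupport f.1 ⊆ V) {c : ℝ≥0} (hc : 0 < c)
    (hf : ∀ z, |f.1 z| ≤ c) (hπ : ∀ i, LipschitzWith 1 (π i).1) :
    ‖T f π‖ₑ ≤ c * massIn T V := by
  have hc' : (0 : ℝ) < c := hc
  have h1 : f = (c : ℝ) • ((c : ℝ)⁻¹ • f) := by rw [smul_smul, mul_inv_cancel₀ hc'.ne', one_smul]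
  have h2 : ‖T ((c : ℝ)⁻¹ • f) π‖ₑ ≤ massIn T V := by
    refine enorm_le_massIn hT
      ((closure_mono (Function.support_const_smul_subset _ f.1)).trans hfV) (fun z => ?_) hπ
    change |(c : ℝ)⁻¹ * f.1 z| ≤ 1
    rw [abs_mul, abs_of_pos (inv_pos.2 hc'), inv_mul_le_iff₀ hc', mul_one]
    exact hf z
  rw [h1, hT.smul_left, enorm_mul]
  gcongr
  simp

variable [MeasurableSpace Z] [BorelSpace Z]

theorem Lipbs.measurable_enorm (f : Lipbs Z) : Measurable fun z => ‖f.1 z‖ₑ :=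
  (Lipbs.continuous f).measurable.enorm

theorem IsTight.lintegral_enorm_ne_top {T : FormFunction Z m} (hT : IsTight T) (f : Lipbs Z) :
    ∫⁻ z, ‖f.1 z‖ₑ ∂massMeasure T ≠ ∞ := by
  obtain ⟨M, hM, h⟩ := Lipbs.exists_abs_le f
  have h1 : ∀ z, ‖f.1 z‖ₑ ≤ (tsupport f.1).indicator (fun _ => ENNReal.ofReal M) z := fun z => by
    by_cases hz : z ∈ tsupport f.1
    · rw [indicator_of_mem hz, Real.enorm_eq_ofReal_abs]
      exact ENNReal.ofReal_le_ofReal (h z)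
    · simp [Lipbs.eq_zero f hz]
  refine ((lintegral_mono h1).trans_lt ?_).ne
  rw [lintegral_indicator_const (isClosed_tsupport _).measurableSet]
  exact ENNReal.mul_lt_top ENNReal.ofReal_lt_top (hT.massMeasure_lt_top f.2.2)

theorem IsTight.integrable {T : FormFunction Z m} (hT : IsTight T) (f : Lipbs Z) :
    Integrable f.1 (massMeasure T) :=
  ⟨(Lipbs.continuous f).measurable.aestronglyMeasurable, (hT.lintegral_enorm_ne_top f).lt_top⟩

/-- Cut `f` into horizontal layers of height ε. The bottom layer min(f, ε) costs ε‖T‖(V). The rest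
is supported in {f ≥ ε}, so the open set {f > 0} can replace `V` in the induction. The cost ε‖T‖{f >
ε} arising there is paid by the integral of min(f, ε), so only two error terms of order ε survive.
-/
theorem IsTight.enorm_le_layer {T : FormFunction Z m} (hT : IsTight T) {π : Fin m → Liploc Z}
    (hπ : ∀ i, LipschitzWith 1 (π i).1) {ε : ℝ≥0} (hε : 0 < ε) (n : ℕ) :
    ∀ f : Lipbs Z, (∀ z, 0 ≤ f.1 z) → (∀ z, f.1 z ≤ n * ε) → ∀ V, IsOpen V → tsupport f.1 ⊆ V →
      ‖T f π‖ₑ ≤ ε * massMeasure T V + ε * massMeasure T {z | 0 < f.1 z} +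
        ∫⁻ z, ‖f.1 z‖ₑ ∂massMeasure T := by
  have hε' : (0 : ℝ) < ε := hε
  induction n with
  | zero =>
    intro f h0 h1 V _ _
    have : f = 0 := Subtype.ext (funext fun z => le_antisymm (by simpa using h1 z) (h0 z))
    rw [this, hT.1.zero_left]
    simp
  | succ n ih =>
    intro f h0 h1 V hV hfV
    have hl1 : ∃ K : ℝ≥0, LipschitzWith K fun x : ℝ => min x ε := ⟨1, LipschitzWith.id.min_const _⟩
    have hl2 : ∃ K : ℝ≥0, LipschitzWith K fun x : ℝ => max (x - ε) 0 :=
      ⟨1 + 0, (LipschitzWith.id.sub (LipschitzWith.const (ε : ℝ))).max_const 0⟩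
    let f₁ := Lipbs.comp f (fun x => min x ε) hl1 (min_eq_left hε'.le)
    let f₂ := Lipbs.comp f (fun x => max (x - ε) 0) hl2
      (max_eq_right (by rw [zero_sub]; exact neg_nonpos.2 hε'.le))
    have hf : f = f₁ + f₂ := by
      ext z
      change f.1 z = min (f.1 z) ε + max (f.1 z - ε) 0
      rcases le_total (f.1 z) ε with h | h
      · rw [min_eq_left h, max_eq_right (by linarith), add_zero]
      · rw [min_eq_right h, max_eq_left (by linarith)]; ring
    have b1 : ‖T f₁ π‖ₑ ≤ ε * massMeasure T V := by
      rw [hT.massMeasure_of_isOpen hV]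
      refine enorm_le_mul_massIn hT.1 ((Lipbs.tsupport_comp_subset _ _ _ _).trans hfV) hε
        (fun z => ?_) hπ
      change |min (f.1 z) ε| ≤ ε
      rw [abs_of_nonneg (le_min (h0 z) hε'.le)]
      exact min_le_right _ _
    have hopen : IsOpen {z | 0 < f.1 z} := isOpen_lt continuous_const (Lipbs.continuous f)
    have hset : {z | 0 < f₂.1 z} = {z | ε < f.1 z} := by
      ext z
      change 0 < max (f.1 z - ε) 0 ↔ (ε : ℝ) < f.1 z
      simp
    have b2 := ih f₂ (fun z => le_max_right _ _) (fun z => by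
      change max (f.1 z - ε) 0 ≤ _
      refine max_le ?_ (by positivity)
      have := h1 z
      push_cast at this
      linarith) {z | 0 < f.1 z} hopen (by
        have hcl : IsClosed {z | (ε : ℝ) ≤ f.1 z} :=
          isClosed_le continuous_const (Lipbs.continuous f)
        refine (tsupport_subset_of_isClosed hcl fun z hz => ?_).trans
          fun z (hz : (ε : ℝ) ≤ f.1 z) => hε'.trans_le hz
        have hz : f.1 z < ε := not_le.1 hz
        exact max_eq_right (by linarith))
    have b3 : ε * massMeasure T {z | ε < f.1 z} + ∫⁻ z, ‖f₂.1 z‖ₑ ∂massMeasure T ≤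
        ∫⁻ z, ‖f.1 z‖ₑ ∂massMeasure T := by
      have hm : MeasurableSet {z | ε < f.1 z} :=
        (isOpen_lt continuous_const (Lipbs.continuous f)).measurableSet
      rw [← lintegral_indicator_const hm, ← lintegral_add_right _ (Lipbs.measurable_enorm f₂)]
      refine lintegral_mono fun z => ?_
      have e1 : ‖f.1 z‖ₑ = ENNReal.ofReal (f.1 z) := by
        rw [Real.enorm_eq_ofReal_abs, abs_of_nonneg (h0 z)]
      have e2 : ‖f₂.1 z‖ₑ = ENNReal.ofReal (max (f.1 z - ε) 0) := by
        rw [Real.enorm_eq_ofReal_abs, abs_of_nonneg (le_max_right _ _)]; rfl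
      rw [e1, e2]
      by_cases hz : (ε : ℝ) < f.1 z
      · rw [indicator_of_mem (by exact hz), max_eq_left (by linarith), ← ENNReal.ofReal_coe_nnreal,
          ← ENNReal.ofReal_add hε'.le (by linarith)]
        simp
      · rw [indicator_of_notMem (by exact hz), max_eq_right (by linarith)]
        simp
    rw [hset] at b2
    calc ‖T f π‖ₑ = ‖T f₁ π + T f₂ π‖ₑ := by rw [← hT.1.add_left, ← hf]
      _ ≤ ‖T f₁ π‖ₑ + ‖T f₂ π‖ₑ := enorm_add_le _ _
      _ ≤ ε * massMeasure T V + (ε * massMeasure T {z | 0 < f.1 z} +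
            ε * massMeasure T {z | ε < f.1 z} + ∫⁻ z, ‖f₂.1 z‖ₑ ∂massMeasure T) := add_le_add b1 b2
      _ = ε * massMeasure T V + ε * massMeasure T {z | 0 < f.1 z} +
            (ε * massMeasure T {z | ε < f.1 z} + ∫⁻ z, ‖f₂.1 z‖ₑ ∂massMeasure T) := by
          rw [add_assoc, add_assoc]
      _ ≤ _ := add_le_add_right b3 _

theorem IsTight.enorm_le_of_nonneg {T : FormFunction Z m} (hT : IsTight T) {π : Fin m → Liploc Z}
    (hπ : ∀ i, LipschitzWith 1 (π i).1) {f : Lipbs Z} (hf : ∀ z, 0 ≤ f.1 z) :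
    ‖T f π‖ₑ ≤ ∫⁻ z, ‖f.1 z‖ₑ ∂massMeasure T := by
  obtain ⟨M, hM, hfM⟩ := Lipbs.exists_abs_le f
  set V := Metric.thickening 1 (tsupport f.1)
  have hV : massMeasure T V ≠ ∞ := (hT.massMeasure_lt_top f.2.2.thickening).ne
  have hV' : massMeasure T {z | 0 < f.1 z} ≤ massMeasure T V := measure_mono fun z hz =>
    Metric.self_subset_thickening one_pos _ (subset_tsupport _ (ne_of_gt hz))
  have key : ∀ ε : ℝ≥0, 0 < ε → ‖T f π‖ₑ ≤ ε * (2 * massMeasure T V) +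
      ∫⁻ z, ‖f.1 z‖ₑ ∂massMeasure T := fun ε hε => by
    obtain ⟨n, hn⟩ := exists_nat_ge (M / ε)
    rw [div_le_iff₀ (by exact_mod_cast hε)] at hn
    refine (hT.enorm_le_layer hπ hε n f hf (fun z => (le_abs_self _).trans ((hfM z).trans hn)) V
      Metric.isOpen_thickening (Metric.self_subset_thickening one_pos _)).trans ?_
    rw [two_mul, mul_add]
    gcongr
  have hlim : Tendsto (fun ε : ℝ≥0 => (ε : ℝ≥0∞) * (2 * massMeasure T V) +
      ∫⁻ z, ‖f.1 z‖ₑ ∂massMeasure T) (𝓝[>] 0) (𝓝 (((0 : ℝ≥0) : ℝ≥0∞) * (2 * massMeasure T V) +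
      ∫⁻ z, ‖f.1 z‖ₑ ∂massMeasure T)) := by
    refine Tendsto.add_const _ (ENNReal.Tendsto.mul_const ?_
      (Or.inr (ENNReal.mul_ne_top (by simp) hV)))
    exact (ENNReal.continuous_coe.tendsto 0).mono_left nhdsWithin_le_nhds
  simp only [ENNReal.coe_zero, zero_mul, zero_add] at hlim
  exact ge_of_tendsto hlim (eventually_mem_nhdsWithin.mono fun ε hε => key ε hε)

theorem IsTight.enorm_le_of_lipschitzWith_one {T : FormFunction Z m} (hT : IsTight T)
    {π : Fin m → Liploc Z} (hπ : ∀ i, LipschitzWith 1 (π i).1) (f : Lipbs Z) :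
    ‖T f π‖ₑ ≤ ∫⁻ z, ‖f.1 z‖ₑ ∂massMeasure T := by
  have hl1 : ∃ K : ℝ≥0, LipschitzWith K fun x : ℝ => max x 0 := ⟨1, LipschitzWith.id.max_const _⟩
  have hl2 : ∃ K : ℝ≥0, LipschitzWith K fun x : ℝ => max (-x) 0 :=
    ⟨1, LipschitzWith.id.neg.max_const 0⟩
  let f₁ := Lipbs.comp f (fun x => max x 0) hl1 (max_self 0)
  let f₂ := Lipbs.comp f (fun x => max (-x) 0) hl2 (by simp)
  have hf : f = f₁ - f₂ := by
    ext z
    change f.1 z = max (f.1 z) 0 - max (-f.1 z) 0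
    rcases le_total (f.1 z) 0 with h | h
    · rw [max_eq_right h, max_eq_left (by linarith)]; ring
    · rw [max_eq_left h, max_eq_right (by linarith)]; ring
  calc ‖T f π‖ₑ = ‖T f₁ π - T f₂ π‖ₑ := by rw [← hT.1.sub_left, ← hf]
    _ ≤ ‖T f₁ π‖ₑ + ‖T f₂ π‖ₑ := enorm_sub_le
    _ ≤ ∫⁻ z, ‖f₁.1 z‖ₑ ∂massMeasure T + ∫⁻ z, ‖f₂.1 z‖ₑ ∂massMeasure T :=
      add_le_add (hT.enorm_le_of_nonneg hπ fun z => le_max_right _ _)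
        (hT.enorm_le_of_nonneg hπ fun z => le_max_right _ _)
    _ = ∫⁻ z, ‖f.1 z‖ₑ ∂massMeasure T := by
      rw [← lintegral_add_left (Lipbs.measurable_enorm f₁)]
      congr 1 with z
      change ‖max (f.1 z) 0‖ₑ + ‖max (-f.1 z) 0‖ₑ = _
      rcases le_total (f.1 z) 0 with h | h
      · rw [max_eq_right h, max_eq_left (by linarith)]; simp
      · rw [max_eq_left h, max_eq_right (by linarith)]; simp

/-- The mass estimate for a current, with the Lipschitz constants on the support. -/
theorem IsTight.enorm_le {T : FormFunction Z m} (hT : IsTight T) (f : Lipbs Z)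
    (π : Fin m → Liploc Z) (L : Fin m → ℝ≥0)
    (hπ : ∀ i, LipschitzOnWith (L i) (π i).1 (tsupport f.1)) :
    ‖T f π‖ₑ ≤ ((∏ i, L i : ℝ≥0) : ℝ≥0∞) * ∫⁻ z, ‖f.1 z‖ₑ ∂massMeasure T := by
  -- Only the restrictions to the support matter: extend them to Lipschitz functions and divide by
  -- the constants. Adding η > 0 avoids division by zero; finally η → 0.
  choose e he heq using fun i => (hπ i).extend_real
  have key : ∀ η : ℝ≥0, 0 < η → ‖T f π‖ₑ ≤ ((∏ i, (L i + η) : ℝ≥0) : ℝ≥0∞) *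
      ∫⁻ z, ‖f.1 z‖ₑ ∂massMeasure T := fun η hη => by
    have hpos : ∀ i, 0 < L i + η := fun i => add_pos_of_nonneg_of_pos zero_le hη
    have hlip : ∀ i, LipschitzWith 1 fun z => ((L i + η : ℝ≥0) : ℝ)⁻¹ * e i z := fun i => by
      refine LipschitzWith.of_dist_le_mul fun x y => ?_
      have h1 := (he i).dist_le_mul x y
      have h2 : (0 : ℝ) < (L i + η : ℝ≥0) := hpos i
      rw [Real.dist_eq] at *
      rw [← mul_sub, abs_mul, abs_of_pos (inv_pos.2 h2), inv_mul_le_iff₀ h2]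
      refine h1.trans ?_
      push_cast
      rw [one_mul]
      gcongr
      simp
    let q : Fin m → Liploc Z := fun i => Liploc.ofLipschitz _ ⟨1, hlip i⟩
    have h1 : T f π = T f (fun i => ((L i + η : ℝ≥0) : ℝ) • q i) := by
      refine hT.1.congr_right fun i z hz => ?_
      change _ = ((L i + η : ℝ≥0) : ℝ) * (((L i + η : ℝ≥0) : ℝ)⁻¹ * e i z)
      rw [mul_inv_cancel_left₀ (by exact_mod_cast (hpos i).ne'), heq i hz]
    have h2 : T f (fun i => ((L i + η : ℝ≥0) : ℝ) • q i) =
        (∏ i, ((L i + η : ℝ≥0) : ℝ)) • T f q :=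
      (hT.1.toMultilinearMap f).map_smul_univ (fun i => ((L i + η : ℝ≥0) : ℝ)) q
    rw [h1, h2, smul_eq_mul, enorm_mul, ← NNReal.coe_prod]
    refine mul_le_mul' (le_of_eq ?_) (hT.enorm_le_of_lipschitzWith_one hlip f)
    generalize (∏ i, (L i + η)) = c
    simp
  have hlim : Tendsto (fun η : ℝ≥0 => ((∏ i, (L i + η) : ℝ≥0) : ℝ≥0∞) *
      ∫⁻ z, ‖f.1 z‖ₑ ∂massMeasure T) (𝓝[>] 0)
      (𝓝 (((∏ i, (L i + 0) : ℝ≥0) : ℝ≥0∞) * ∫⁻ z, ‖f.1 z‖ₑ ∂massMeasure T)) := by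
    refine ENNReal.Tendsto.mul_const ?_ (Or.inr (hT.lintegral_enorm_ne_top f))
    have hc : Continuous fun η : ℝ≥0 => ((∏ i, (L i + η) : ℝ≥0) : ℝ≥0∞) :=
      ENNReal.continuous_coe.comp (by fun_prop)
    exact (hc.tendsto 0).mono_left nhdsWithin_le_nhds
  simp only [add_zero] at hlim
  exact ge_of_tendsto hlim (eventually_mem_nhdsWithin.mono fun ε hε => key ε hε)

theorem IsTight.abs_apply_le {T : FormFunction Z m} (hT : IsTight T) (f : Lipbs Z)
    (π : Fin m → Liploc Z) (L : Fin m → ℝ≥0)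
    (hπ : ∀ i, LipschitzOnWith (L i) (π i).1 (tsupport f.1)) :
    |T f π| ≤ ((∏ i, L i : ℝ≥0) : ℝ) * ∫ z, ‖f.1 z‖ ∂massMeasure T := by
  have h := hT.enorm_le f π L hπ
  rw [← ofReal_integral_norm_eq_lintegral_enorm (hT.integrable f), ← ENNReal.ofReal_coe_nnreal,
    ← ENNReal.ofReal_mul (NNReal.coe_nonneg _), Real.enorm_eq_ofReal_abs] at h
  exact (ENNReal.ofReal_le_ofReal_iff (mul_nonneg (NNReal.coe_nonneg _)
    (integral_nonneg fun _ => norm_nonneg _))).1 h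

end

/-! ### The product rule -/

noncomputable section

variable {Z : Type*} [MetricSpace Z] {m : ℕ}

theorem tsupport_mul_right_subset (f : Lipbs Z) (g : Liploc Z) :
    tsupport (Lipbs.mul f g).1 ⊆ tsupport g.1 :=
  closure_mono fun z hz => by
    rw [Function.mem_support] at hz ⊢
    exact right_ne_zero_of_mul hz

/-- The defect of the chain rule for the square of `g`. -/
def squareDefect (T : FormFunction Z (m + 1)) (g : Liploc Z) (π : Fin m → Liploc Z)
    (f : Lipbs Z) : ℝ :=
  T f (Fin.cons (Liploc.mul g g) π) - 2 * T (Lipbs.mul f g) (Fin.cons g π)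

theorem squareDefect_add {T : FormFunction Z (m + 1)} (hT : IsMetricFunctional T) (g : Liploc Z)
    (π : Fin m → Liploc Z) (f₁ f₂ : Lipbs Z) :
    squareDefect T g π (f₁ + f₂) = squareDefect T g π f₁ + squareDefect T g π f₂ := by
  have h : Lipbs.mul (f₁ + f₂) g = Lipbs.mul f₁ g + Lipbs.mul f₂ g :=
    Subtype.ext (funext fun z => add_mul _ _ _)
  simp only [squareDefect]
  rw [h, hT.add_left, hT.add_left]
  ring

theorem IsMetricFunctional.cons_const {T : FormFunction Z (m + 1)} (hT : IsMetricFunctional T)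
    (f : Lipbs Z) (c : ℝ) (π : Fin m → Liploc Z) : T f (Fin.cons (Liploc.const Z c) π) = 0 :=
  hT.eq_zero_of_eq_const 0 c fun _ _ => rfl

/-- Since constants in the first component give zero, the defect depends on `g` only up to a
constant. So its oscillation on the support of `f` matters, not its size. -/
theorem squareDefect_eq_sub_const {T : FormFunction Z (m + 1)} (hT : IsMetricFunctional T)
    (g : Liploc Z) (π : Fin m → Liploc Z) (f : Lipbs Z) (c : ℝ) :
    squareDefect T g π f =
      T f (Fin.cons (Liploc.mul (g - Liploc.const Z c) (g - Liploc.const Z c)) π) -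
        2 * T (Lipbs.mul f (g - Liploc.const Z c)) (Fin.cons g π) := by
  have h1 : Liploc.mul (g - Liploc.const Z c) (g - Liploc.const Z c) =
      Liploc.mul g g - (2 * c) • g + Liploc.const Z (c ^ 2) := by
    ext z
    change (g.1 z - c) * (g.1 z - c) = g.1 z * g.1 z - 2 * c * g.1 z + c ^ 2
    ring
  have h2 : Lipbs.mul f (g - Liploc.const Z c) = Lipbs.mul f g - c • f := by
    ext z
    change f.1 z * (g.1 z - c) = f.1 z * g.1 z - c * f.1 z
    ring
  have hl := hT.isLinearMap_cons f π
  have h3 := hl.map_add (Liploc.mul g g - (2 * c) • g) (Liploc.const Z (c ^ 2))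
  have h4 := hl.map_sub (Liploc.mul g g) ((2 * c) • g)
  have h5 := hl.map_smul (2 * c) g
  simp only [hT.cons_const, smul_eq_mul] at h3 h4 h5
  rw [squareDefect, h1, h2, h3, h4, h5, hT.sub_left, hT.smul_left]
  ring

variable [MeasurableSpace Z] [BorelSpace Z]

/-- On the support of `f`, (g - c)² has Lipschitz constant at most 2wK, and |f (g - c)| ≤ w|f|
enters with a factor 2; together this gives the constant 4. -/
theorem IsTight.abs_squareDefect_le {T : FormFunction Z (m + 1)} (hT : IsTight T) {g : Liploc Z}
    {π : Fin m → Liploc Z} {S : Set Z} {K : ℝ≥0} {L : Fin m → ℝ≥0}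
    (hg : LipschitzOnWith K g.1 S) (hπ : ∀ i, LipschitzOnWith (L i) (π i).1 S)
    (f : Lipbs Z) (hf : tsupport f.1 ⊆ S) (w : ℝ≥0) (c : ℝ)
    (hw : ∀ z ∈ tsupport f.1, |g.1 z - c| ≤ w) :
    |squareDefect T g π f| ≤ 4 * K * (∏ i, L i : ℝ≥0) * w * ∫ z, ‖f.1 z‖ ∂massMeasure T := by
  have hgc : LipschitzOnWith K (g - Liploc.const Z c).1 (tsupport f.1) :=
    LipschitzOnWith.of_dist_le_mul fun x hx y hy => by
      have := (hg.mono hf).dist_le_mul x hx y hy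
      rw [Real.dist_eq] at *
      change |(g.1 x - c) - (g.1 y - c)| ≤ _
      rwa [sub_sub_sub_cancel_right]
  have b1 := hT.abs_apply_le f (Fin.cons (Liploc.mul (g - Liploc.const Z c) (g - Liploc.const Z c)) π)
    (Fin.cons (w * K + w * K) L) (fun i => by
      refine Fin.cases ?_ (fun i => ?_) i
      · exact lipschitzOnWith_mul hgc hgc hw hw
      · simpa using (hπ i).mono hf)
  have b2 := hT.abs_apply_le (Lipbs.mul f (g - Liploc.const Z c)) (Fin.cons g π)
    (Fin.cons K L) (fun i => by
      refine Fin.cases ?_ (fun i => ?_) i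
      · simpa using hg.mono ((Lipbs.tsupport_mul_subset _ _).trans hf)
      · simpa using (hπ i).mono ((Lipbs.tsupport_mul_subset _ _).trans hf))
  have b3 : ∫ z, ‖(Lipbs.mul f (g - Liploc.const Z c)).1 z‖ ∂massMeasure T ≤
      w * ∫ z, ‖f.1 z‖ ∂massMeasure T := by
    rw [← integral_const_mul]
    refine integral_mono (hT.integrable _).norm ((hT.integrable f).norm.const_mul _) fun z => ?_
    change ‖f.1 z * (g.1 z - c)‖ ≤ w * ‖f.1 z‖
    rw [norm_mul, mul_comm]
    by_cases hz : z ∈ tsupport f.1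
    · exact mul_le_mul_of_nonneg_right (hw z hz) (norm_nonneg _)
    · simp [Lipbs.eq_zero f hz]
  rw [squareDefect_eq_sub_const hT.1 g π f c]
  rw [Fin.prod_cons] at b1 b2
  push_cast at b1 b2
  have b4 := b2.trans (mul_le_mul_of_nonneg_left b3 (by positivity))
  refine (abs_sub _ _).trans ?_
  rw [abs_mul, abs_two]
  push_cast
  calc _ ≤ (w * K + w * K) * (∏ i, (L i : ℝ)) * ∫ z, ‖f.1 z‖ ∂massMeasure T +
        2 * (K * (∏ i, (L i : ℝ)) * (w * ∫ z, ‖f.1 z‖ ∂massMeasure T)) := by gcongr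
    _ = _ := by ring

/-- Splitting `f` by a partition of unity in the values of `g` reduces the oscillation bound by the
factor 3/4, while the L¹ norms of the two pieces add up to that of `f`. The previous bound is a
product of the two quantities, so every splitting gains a factor 3/4, and the defect must vanish. -/
theorem IsTight.abs_squareDefect_le_pow {T : FormFunction Z (m + 1)} (hT : IsTight T)
    {g : Liploc Z} {π : Fin m → Liploc Z} {S : Set Z} {K : ℝ≥0} {L : Fin m → ℝ≥0}
    (hg : LipschitzOnWith K g.1 S) (hπ : ∀ i, LipschitzOnWith (L i) (π i).1 S) (n : ℕ) :
    ∀ (f : Lipbs Z), tsupport f.1 ⊆ S → ∀ (w : ℝ≥0) (c : ℝ),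
      (∀ z ∈ tsupport f.1, |g.1 z - c| ≤ w) →
      |squareDefect T g π f| ≤ 4 * K * (∏ i, L i : ℝ≥0) * w * (3 / 4) ^ n *
        ∫ z, ‖f.1 z‖ ∂massMeasure T := by
  induction n with
  | zero =>
    intro f hf w c hw
    simpa using hT.abs_squareDefect_le hg hπ f hf w c hw
  | succ n ih =>
    intro f hf w c hw
    rcases eq_or_ne w 0 with rfl | hw0
    · have := hT.abs_squareDefect_le hg hπ f hf 0 c hw
      simpa using this
    have hwpos : (0 : ℝ) < w := by exact_mod_cast pos_iff_ne_zero.2 hw0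
    have hφ : LipschitzWith (0 + ‖(w : ℝ)⁻¹‖₊ * (1 + 0))
        (fun x : ℝ => 1 / 2 + (w : ℝ)⁻¹ * (x - c)) :=
      (LipschitzWith.const (1 / 2 : ℝ)).add
        ((lipschitzWith_smul (w : ℝ)⁻¹).comp (LipschitzWith.id.sub (LipschitzWith.const c)))
    -- φ rises from 0 to 1 on [c - w/2, c + w/2]. On the supports of the two pieces `g` takes values
    -- in [c - w/2, c + w] and [c - w, c + w/2], of half-width 3w/4 about c ± w/4.
    set φ : ℝ → ℝ := fun x => max 0 (min 1 (1 / 2 + (w : ℝ)⁻¹ * (x - c))) with hφdef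
    have hφ1 : ∃ K : ℝ≥0, LipschitzWith K φ := ⟨_, (hφ.const_min 1).const_max 0⟩
    have hφ2 : ∃ K : ℝ≥0, LipschitzWith K fun x => 1 - φ x := by
      obtain ⟨K, hK⟩ := hφ1
      exact ⟨0 + K, (LipschitzWith.const 1).sub hK⟩
    have h01 : ∀ x, 0 ≤ φ x ∧ φ x ≤ 1 := fun x =>
      ⟨le_max_left _ _, max_le zero_le_one (min_le_left _ _)⟩
    have hφ0 : ∀ x, x ≤ c - w / 2 → φ x = 0 := fun x hx => by
      refine max_eq_left ((min_le_right _ _).trans ?_)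
      have : (w : ℝ)⁻¹ * (x - c) ≤ -(1 / 2) := by
        rw [inv_mul_le_iff₀ hwpos]; linarith
      linarith
    have hφ1' : ∀ x, c + w / 2 ≤ x → 1 - φ x = 0 := fun x hx => by
      have : 1 / 2 ≤ (w : ℝ)⁻¹ * (x - c) := by
        rw [le_inv_mul_iff₀ hwpos]; linarith
      simp only [hφdef]
      rw [min_eq_left (by linarith), max_eq_right zero_le_one, sub_self]
    let s : Liploc Z := Liploc.comp g φ hφ1
    let t : Liploc Z := Liploc.comp g (fun x => 1 - φ x) hφ2
    have hsum : f = Lipbs.mul f s + Lipbs.mul f t := by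
      ext z
      change f.1 z = f.1 z * φ (g.1 z) + f.1 z * (1 - φ (g.1 z))
      ring
    have hs : ∀ z ∈ tsupport (Lipbs.mul f s).1, |g.1 z - (c + w / 4)| ≤ (3 / 4 * w : ℝ≥0) := by
      intro z hz
      have h1 := abs_le.1 (hw z (Lipbs.tsupport_mul_subset _ _ hz))
      have hcl : IsClosed {z | c - w / 2 ≤ g.1 z} :=
        isClosed_le continuous_const (Liploc.continuous g)
      have h2 : c - w / 2 ≤ g.1 z := (tsupport_subset_of_isClosed hcl
        fun z hz => hφ0 _ (not_le.1 hz).le) (tsupport_mul_right_subset _ _ hz)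
      push_cast
      exact abs_le.2 ⟨by linarith, by linarith⟩
    have ht : ∀ z ∈ tsupport (Lipbs.mul f t).1, |g.1 z - (c - w / 4)| ≤ (3 / 4 * w : ℝ≥0) := by
      intro z hz
      have h1 := abs_le.1 (hw z (Lipbs.tsupport_mul_subset _ _ hz))
      have hcl : IsClosed {z | g.1 z ≤ c + w / 2} :=
        isClosed_le (Liploc.continuous g) continuous_const
      have h2 : g.1 z ≤ c + w / 2 := (tsupport_subset_of_isClosed hcl
        fun z hz => hφ1' _ (not_le.1 hz).le) (tsupport_mul_right_subset _ _ hz)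
      push_cast
      exact abs_le.2 ⟨by linarith, by linarith⟩
    have e1 := ih _ ((Lipbs.tsupport_mul_subset f s).trans hf) _ _ hs
    have e2 := ih _ ((Lipbs.tsupport_mul_subset f t).trans hf) _ _ ht
    have e3 : ∫ z, ‖f.1 z‖ ∂massMeasure T = ∫ z, ‖(Lipbs.mul f s).1 z‖ ∂massMeasure T +
        ∫ z, ‖(Lipbs.mul f t).1 z‖ ∂massMeasure T := by
      rw [← integral_add (hT.integrable _).norm (hT.integrable _).norm]
      congr 1 with z
      change ‖f.1 z‖ = ‖f.1 z * φ (g.1 z)‖ + ‖f.1 z * (1 - φ (g.1 z))‖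
      obtain ⟨h0, h1⟩ := h01 (g.1 z)
      rw [norm_mul, norm_mul, Real.norm_of_nonneg h0, Real.norm_of_nonneg (sub_nonneg.2 h1)]
      ring
    have e4 : squareDefect T g π f = squareDefect T g π (Lipbs.mul f s) +
        squareDefect T g π (Lipbs.mul f t) := by rw [← squareDefect_add hT.1, ← hsum]
    rw [e3, e4]
    refine (abs_add_le _ _).trans ((add_le_add e1 e2).trans (le_of_eq ?_))
    push_cast
    ring

theorem IsTight.squareDefect_eq_zero {T : FormFunction Z (m + 1)} (hT : IsTight T)
    (g : Liploc Z) (π : Fin m → Liploc Z) (f : Lipbs Z) : squareDefect T g π f = 0 := by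
  obtain ⟨K, hK⟩ := g.2 _ f.2.2
  choose L hL using fun i => (π i).2 _ f.2.2
  obtain ⟨M, hM, hgM⟩ := Liploc.exists_abs_le g f.2.2
  have key := fun n => hT.abs_squareDefect_le_pow hK hL n f Subset.rfl ⟨M, hM⟩ 0
    (fun z hz => by rw [sub_zero]; exact hgM z hz)
  have hlim : Tendsto (fun n : ℕ => 4 * K * (∏ i, L i : ℝ≥0) * (⟨M, hM⟩ : ℝ≥0) * (3 / 4 : ℝ) ^ n *
      ∫ z, ‖f.1 z‖ ∂massMeasure T) atTop (𝓝 (4 * K * (∏ i, L i : ℝ≥0) * (⟨M, hM⟩ : ℝ≥0) * 0 *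
      ∫ z, ‖f.1 z‖ ∂massMeasure T)) :=
    ((tendsto_pow_atTop_nhds_zero_of_lt_one (by norm_num) (by norm_num)).const_mul _).mul_const _
  rw [mul_zero, zero_mul] at hlim
  exact abs_nonpos_iff.1 (ge_of_tendsto' hlim key)

/-- The product rule. -/
theorem IsTight.product_rule {T : FormFunction Z (m + 1)} (hT : IsTight T) (f : Lipbs Z)
    (g h : Liploc Z) (π : Fin m → Liploc Z) :
    T f (Fin.cons (Liploc.mul g h) π) =
      T (Lipbs.mul f g) (Fin.cons h π) + T (Lipbs.mul f h) (Fin.cons g π) := by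
  -- Polarization of the chain rule for squares.
  have h1 := sub_eq_zero.1 (hT.squareDefect_eq_zero (g + h) π f)
  have h2 := sub_eq_zero.1 (hT.squareDefect_eq_zero g π f)
  have h3 := sub_eq_zero.1 (hT.squareDefect_eq_zero h π f)
  have e1 : Liploc.mul (g + h) (g + h) = Liploc.mul g g + (2 : ℝ) • Liploc.mul g h +
      Liploc.mul h h := by
    ext z
    change (g.1 z + h.1 z) * (g.1 z + h.1 z) =
      g.1 z * g.1 z + 2 * (g.1 z * h.1 z) + h.1 z * h.1 z
    ring
  have e2 : Lipbs.mul f (g + h) = Lipbs.mul f g + Lipbs.mul f h :=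
    Subtype.ext (funext fun z => mul_add _ _ _)
  have hl := hT.1.isLinearMap_cons f π
  have hg := (hT.1.isLinearMap_cons (Lipbs.mul f g) π).map_add g h
  have hh := (hT.1.isLinearMap_cons (Lipbs.mul f h) π).map_add g h
  have a1 := hl.map_add (Liploc.mul g g + (2 : ℝ) • Liploc.mul g h) (Liploc.mul h h)
  have a2 := hl.map_add (Liploc.mul g g) ((2 : ℝ) • Liploc.mul g h)
  have a3 := hl.map_smul 2 (Liploc.mul g h)
  simp only [smul_eq_mul] at a1 a2 a3 hg hh
  rw [e1, e2, hT.1.add_left, a1, a2, a3, hg, hh, h2, h3] at h1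
  linarith

end

/-! ### Extension to sublevel sets and the limit formula for slices -/

noncomputable section

variable {Z : Type*} [MetricSpace Z] {m : ℕ}

theorem Lipbs.tsupport_sub_subset (f g : Lipbs Z) {N : Set Z} (hf : tsupport f.1 ⊆ N)
    (hg : tsupport g.1 ⊆ N) : tsupport (f - g).1 ⊆ N := by
  refine (tsupport_subset_of_isClosed ((isClosed_tsupport f.1).union (isClosed_tsupport g.1))
    fun z hz => ?_).trans (union_subset hf hg)
  rw [mem_union, not_or] at hz
  change f.1 z - g.1 z = 0
  rw [Lipbs.eq_zero f hz.1, Lipbs.eq_zero g hz.2, sub_zero]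

theorem lipschitzWith_lipConst {ρ : Z → ℝ} (hρ : ∃ K : ℝ≥0, LipschitzWith K ρ) :
    LipschitzWith (lipConst ρ) ρ := by
  have hcl : IsClosed {K : ℝ≥0 | LipschitzWith K ρ} := by
    simp only [LipschitzWith, ofPred_forall]
    exact isClosed_iInter fun x => isClosed_iInter fun y => isClosed_le continuous_const
      ((ENNReal.continuous_mul_const (edist_ne_top x y)).comp ENNReal.continuous_coe)
  exact hcl.csInf_mem hρ (OrderBot.bddBelow _)

/-- The piecewise affine function that grows from `0` to `1` on the interval
`[r, r + 1 / (n + 1)]`. -/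
def rampFun (r : ℝ) (n : ℕ) (x : ℝ) : ℝ := max 0 (min 1 ((n + 1) * (x - r)))

theorem rampFun_lipschitz (r : ℝ) (n : ℕ) : LipschitzWith (n + 1) (rampFun r n) := by
  have h : LipschitzWith (n + 1) fun x : ℝ => ((n : ℝ) + 1) * (x - r) := by
    refine LipschitzWith.of_dist_le_mul fun x y => ?_
    rw [Real.dist_eq, Real.dist_eq, ← mul_sub, abs_mul, sub_sub_sub_cancel_right,
      abs_of_pos (by positivity)]
    push_cast
    exact le_rfl
  exact (h.const_min 1).const_max 0

theorem rampFun_nonneg (r : ℝ) (n : ℕ) (x : ℝ) : 0 ≤ rampFun r n x := le_max_left _ _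

theorem rampFun_le_one (r : ℝ) (n : ℕ) (x : ℝ) : rampFun r n x ≤ 1 :=
  max_le zero_le_one (min_le_left _ _)

theorem rampFun_eq_zero {r x : ℝ} (n : ℕ) (h : x ≤ r) : rampFun r n x = 0 :=
  max_eq_left ((min_le_right _ _).trans
    (mul_nonpos_of_nonneg_of_nonpos (by positivity) (by linarith)))

theorem rampFun_eq_one {r x : ℝ} {n : ℕ} (h : r + 1 / (n + 1) ≤ x) : rampFun r n x = 1 := by
  have h1 : (1 : ℝ) ≤ (n + 1) * (x - r) := by
    have : 1 / ((n : ℝ) + 1) ≤ x - r := by linarith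
    rwa [div_le_iff₀' (by positivity)] at this
  rw [rampFun, min_eq_left h1, max_eq_right zero_le_one]

theorem rampFun_eventually_eq_one {r x : ℝ} (h : r < x) : ∀ᶠ n in atTop, rampFun r n x = 1 := by
  have := (tendsto_one_div_add_atTop_nhds_zero_nat (𝕜 := ℝ)).eventually (gt_mem_nhds (sub_pos.2 h))
  exact this.mono fun n hn => rampFun_eq_one (by linarith)

/-- The composition of `rampFun` with a Lipschitz function. -/
def ramp (ρ : Z → ℝ) (hρ : ∃ K : ℝ≥0, LipschitzWith K ρ) (r : ℝ) (n : ℕ) : Liploc Z :=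
  Liploc.comp (Liploc.ofLipschitz ρ hρ) (rampFun r n) ⟨_, rampFun_lipschitz r n⟩

theorem ramp_lipschitz {ρ : Z → ℝ} (hρ : ∃ K : ℝ≥0, LipschitzWith K ρ) (r : ℝ) (n : ℕ) :
    LipschitzWith ((n + 1) * lipConst ρ) (ramp ρ hρ r n).1 :=
  (rampFun_lipschitz r n).comp (lipschitzWith_lipConst hρ)

/-- Lipschitz approximations of `1_{ρ ≤ r} f`. -/
def sublevelApprox (ρ : Z → ℝ) (hρ : ∃ K : ℝ≥0, LipschitzWith K ρ) (r : ℝ) (f : Lipbs Z) (n : ℕ) :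
    Lipbs Z :=
  Lipbs.mul f (Liploc.const Z 1 - ramp ρ hρ r n)

theorem sublevelApprox_apply {ρ : Z → ℝ} (hρ : ∃ K : ℝ≥0, LipschitzWith K ρ) (r : ℝ) (f : Lipbs Z)
    (n : ℕ) (z : Z) : (sublevelApprox ρ hρ r f n).1 z = f.1 z * (1 - rampFun r n (ρ z)) := rfl

theorem tsupport_sublevelApprox_subset {ρ : Z → ℝ} (hρ : ∃ K : ℝ≥0, LipschitzWith K ρ) (r : ℝ)
    (f : Lipbs Z) (n : ℕ) : tsupport (sublevelApprox ρ hρ r f n).1 ⊆ tsupport f.1 :=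
  Lipbs.tsupport_mul_subset _ _

theorem sublevelApprox_add {ρ : Z → ℝ} (hρ : ∃ K : ℝ≥0, LipschitzWith K ρ) (r : ℝ) (f g : Lipbs Z)
    (n : ℕ) : sublevelApprox ρ hρ r (f + g) n =
      sublevelApprox ρ hρ r f n + sublevelApprox ρ hρ r g n :=
  Subtype.ext (funext fun _ => add_mul _ _ _)

theorem sublevelApprox_smul {ρ : Z → ℝ} (hρ : ∃ K : ℝ≥0, LipschitzWith K ρ) (r : ℝ) (c : ℝ)
    (f : Lipbs Z) (n : ℕ) : sublevelApprox ρ hρ r (c • f) n = c • sublevelApprox ρ hρ r f n :=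
  Subtype.ext (funext fun _ => mul_assoc _ _ _)

theorem IsMetricFunctional.sub {S T : FormFunction Z m} (hS : IsMetricFunctional S)
    (hT : IsMetricFunctional T) : IsMetricFunctional (S - T) where
  linear_left π := (hS.linear_left π).mk' _ - (hT.linear_left π).mk' _ |>.isLinear
  linear_right f π i := (hS.linear_right f π i).mk' _ - (hT.linear_right f π i).mk' _ |>.isLinear
  continuous f π πs h1 h2 := (hS.continuous f π πs h1 h2).sub (hT.continuous f π πs h1 h2)
  local' f π h := by
    change S f π - T f π = 0
    rw [hS.local' f π h, hT.local' f π h, sub_zero]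

variable [MeasurableSpace Z]

theorem IsApprox.tendsto_enorm {T : FormFunction Z m} {f : Z → ℝ} {u : ℕ → Lipbs Z}
    (hu : IsApprox T f u) :
    Tendsto (fun k => ∫⁻ z, ‖(u k).1 z - f z‖ₑ ∂massMeasure T) atTop (𝓝 0) := by
  simp only [Real.enorm_eq_ofReal_abs]
  exact hu.tendsto

theorem isApprox_const {T : FormFunction Z m} (u : Lipbs Z) :
    IsApprox T u.1 fun _ => u :=
  ⟨⟨_, u.2.2, fun _ => Subset.rfl⟩, by simp⟩

variable [BorelSpace Z]

theorem IsTight.enorm_sub_le {T : FormFunction Z m} (hT : IsTight T) {u v : Lipbs Z} {N : Set Z}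
    (hu : tsupport u.1 ⊆ N) (hv : tsupport v.1 ⊆ N) {π : Fin m → Liploc Z} {L : Fin m → ℝ≥0}
    (hπ : ∀ i, LipschitzOnWith (L i) (π i).1 N) :
    ‖T u π - T v π‖ₑ ≤
      ((∏ i, L i : ℝ≥0) : ℝ≥0∞) * ∫⁻ z, ‖u.1 z - v.1 z‖ₑ ∂massMeasure T := by
  rw [← hT.1.sub_left]
  exact hT.enorm_le (u - v) π L fun i => (hπ i).mono (Lipbs.tsupport_sub_subset u v hu hv)

theorem lintegral_enorm_sub_le (μ : Measure Z) {f : Z → ℝ} (hf : Measurable f) (u v : Lipbs Z) :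
    ∫⁻ z, ‖u.1 z - v.1 z‖ₑ ∂μ ≤ ∫⁻ z, ‖u.1 z - f z‖ₑ ∂μ + ∫⁻ z, ‖v.1 z - f z‖ₑ ∂μ := by
  have m1 : Measurable fun z => ‖u.1 z - f z‖ₑ := ((Lipbs.continuous u).measurable.sub hf).enorm
  rw [← lintegral_add_left m1]
  refine lintegral_mono fun z => ?_
  calc ‖u.1 z - v.1 z‖ₑ = ‖(u.1 z - f z) - (v.1 z - f z)‖ₑ := by rw [sub_sub_sub_cancel_right]
    _ ≤ _ := _root_.enorm_sub_le

/-- Two sequences are treated at once: u = v gives existence of the limit, the general case its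
independence of the sequence. The mass estimate is used with Lipschitz constants on one bounded set
containing all supports. -/
theorem IsTight.cauchy_bound {T : FormFunction Z m} (hT : IsTight T) {f : Z → ℝ}
    (hf : Measurable f) {u v : ℕ → Lipbs Z} (hu : IsApprox T f u) (hv : IsApprox T f v)
    (π : Fin m → Liploc Z) : ∀ ε : ℝ≥0∞, 0 < ε → ∃ N, ∀ j ≥ N, ∀ k ≥ N,
      edist (T (u j) π) (T (v k) π) < ε := by
  intro ε hε
  obtain ⟨A, hA, huA⟩ := hu.support_subset
  obtain ⟨B, hB, hvB⟩ := hv.support_subset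
  choose L hL using fun i => (π i).2 _ (hA.union hB)
  have h1 := ENNReal.Tendsto.const_mul hu.tendsto_enorm
    (Or.inr (ENNReal.coe_ne_top (r := ∏ i, L i)))
  have h2 := ENNReal.Tendsto.const_mul hv.tendsto_enorm
    (Or.inr (ENNReal.coe_ne_top (r := ∏ i, L i)))
  rw [mul_zero] at h1 h2
  obtain ⟨N, hN⟩ := eventually_atTop.1 ((h1.eventually (gt_mem_nhds (ENNReal.half_pos hε.ne'))).and
    (h2.eventually (gt_mem_nhds (ENNReal.half_pos hε.ne'))))
  refine ⟨N, fun j hj k hk => ?_⟩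
  rw [edist_eq_enorm_sub]
  refine (hT.enorm_sub_le ((huA j).trans subset_union_left) ((hvB k).trans subset_union_right)
    hL).trans_lt ?_
  calc _ ≤ ((∏ i, L i : ℝ≥0) : ℝ≥0∞) * (∫⁻ z, ‖(u j).1 z - f z‖ₑ ∂massMeasure T +
        ∫⁻ z, ‖(v k).1 z - f z‖ₑ ∂massMeasure T) := by
        gcongr
        exact lintegral_enorm_sub_le _ hf _ _
    _ < ε / 2 + ε / 2 := by
        rw [mul_add]
        exact ENNReal.add_lt_add (hN j hj).1 (hN k hk).2
    _ = ε := ENNReal.add_halves ε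

theorem IsTight.tendsto_extend {T : FormFunction Z m} (hT : IsTight T) {f : Z → ℝ}
    (hf : Measurable f) {u : ℕ → Lipbs Z} (hu : IsApprox T f u) (π : Fin m → Liploc Z) :
    Tendsto (fun k => T (u k) π) atTop (𝓝 (extend T f π)) := by
  have h : ∃ u : ℕ → Lipbs Z, IsApprox T f u := ⟨u, hu⟩
  have hv := h.choose_spec
  rw [extend, dif_pos h]
  have hc : CauchySeq fun k => T (h.choose k) π :=
    EMetric.cauchySeq_iff.2 fun ε hε => hT.cauchy_bound hf hv hv π ε hε
  have hlim := tendsto_nhds_limUnder (cauchySeq_tendsto_of_complete hc)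
  rw [EMetric.tendsto_atTop] at hlim ⊢
  intro ε hε
  obtain ⟨N, hN⟩ := hT.cauchy_bound hf hu hv π (ε / 2) (ENNReal.half_pos hε.ne')
  obtain ⟨M, hM⟩ := hlim (ε / 2) (ENNReal.half_pos hε.ne')
  refine ⟨N, fun k hk => (edist_triangle _ (T (h.choose (max N M)) π) _).trans_lt ?_⟩
  rw [← ENNReal.add_halves ε]
  exact ENNReal.add_lt_add (hN k hk _ (le_max_left _ _)) (hM _ (le_max_right _ _))

theorem IsTight.extend_lipbs {T : FormFunction Z m} (hT : IsTight T) (u : Lipbs Z)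
    (π : Fin m → Liploc Z) : extend T u.1 π = T u π :=
  (tendsto_nhds_unique tendsto_const_nhds
    (hT.tendsto_extend (Lipbs.continuous u).measurable (isApprox_const u) π)).symm

theorem IsTight.enorm_extend_sub_le {T : FormFunction Z m} (hT : IsTight T) {f g : Z → ℝ}
    (hf : Measurable f) (hg : Measurable g) {u v : ℕ → Lipbs Z} (hu : IsApprox T f u)
    (hv : IsApprox T g v) {N : Set Z} (huN : ∀ k, tsupport (u k).1 ⊆ N)
    (hvN : ∀ k, tsupport (v k).1 ⊆ N) {π : Fin m → Liploc Z} {L : Fin m → ℝ≥0}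
    (hπ : ∀ i, LipschitzOnWith (L i) (π i).1 N) :
    ‖extend T f π - extend T g π‖ₑ ≤
      ((∏ i, L i : ℝ≥0) : ℝ≥0∞) * ∫⁻ z, ‖f z - g z‖ₑ ∂massMeasure T := by
  have h1 : Tendsto (fun k => ‖T (u k) π - T (v k) π‖ₑ) atTop
      (𝓝 ‖extend T f π - extend T g π‖ₑ) :=
    ((hT.tendsto_extend hf hu π).sub (hT.tendsto_extend hg hv π)).enorm
  have h2 : Tendsto (fun k => ((∏ i, L i : ℝ≥0) : ℝ≥0∞) *
      (∫⁻ z, ‖(u k).1 z - f z‖ₑ ∂massMeasure T + ∫⁻ z, ‖(v k).1 z - g z‖ₑ ∂massMeasure T +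
        ∫⁻ z, ‖f z - g z‖ₑ ∂massMeasure T)) atTop
      (𝓝 (((∏ i, L i : ℝ≥0) : ℝ≥0∞) * (0 + 0 + ∫⁻ z, ‖f z - g z‖ₑ ∂massMeasure T))) :=
    ENNReal.Tendsto.const_mul ((hu.tendsto_enorm.add hv.tendsto_enorm).add_const _)
      (Or.inr ENNReal.coe_ne_top)
  rw [zero_add, zero_add] at h2
  refine le_of_tendsto_of_tendsto' h1 h2 fun k => (hT.enorm_sub_le (huN k) (hvN k) hπ).trans ?_
  gcongr
  have m1 : Measurable fun z => ‖(u k).1 z - f z‖ₑ :=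
    ((Lipbs.continuous (u k)).measurable.sub hf).enorm
  have m2 : Measurable fun z => ‖(v k).1 z - g z‖ₑ :=
    ((Lipbs.continuous (v k)).measurable.sub hg).enorm
  have m3 : Measurable fun z => ‖(u k).1 z - f z‖ₑ + ‖(v k).1 z - g z‖ₑ := m1.add m2
  rw [← lintegral_add_left m1, ← lintegral_add_left m3]
  refine lintegral_mono fun z => ?_
  calc ‖(u k).1 z - (v k).1 z‖ₑ
      = ‖((u k).1 z - f z) - ((v k).1 z - g z) + (f z - g z)‖ₑ := by congr 1; ring
    _ ≤ ‖((u k).1 z - f z) - ((v k).1 z - g z)‖ₑ + ‖f z - g z‖ₑ := enorm_add_le _ _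
    _ ≤ _ := by gcongr; exact _root_.enorm_sub_le

theorem measurableSet_sublevel {ρ : Z → ℝ} (hρ : ∃ K : ℝ≥0, LipschitzWith K ρ) (r : ℝ) :
    MeasurableSet {z | ρ z ≤ r} :=
  (isClosed_le hρ.choose_spec.continuous continuous_const).measurableSet

theorem measurable_indicator_sublevel {ρ : Z → ℝ} (hρ : ∃ K : ℝ≥0, LipschitzWith K ρ) (r : ℝ)
    (f : Lipbs Z) : Measurable ({z | ρ z ≤ r}.indicator f.1) :=
  (Lipbs.continuous f).measurable.indicator (measurableSet_sublevel hρ r)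

/-- The ramp starts at `r`, so the approximants equal `f` on all of {ρ ≤ r}, including the level
set, and eventually vanish at each other point; |f| dominates them. -/
theorem IsTight.isApprox_sublevel {T : FormFunction Z m} (hT : IsTight T) {ρ : Z → ℝ}
    (hρ : ∃ K : ℝ≥0, LipschitzWith K ρ) (r : ℝ) (f : Lipbs Z) :
    IsApprox T ({z | ρ z ≤ r}.indicator f.1) (sublevelApprox ρ hρ r f) := by
  refine ⟨⟨_, f.2.2, tsupport_sublevelApprox_subset hρ r f⟩, ?_⟩
  have hval : ∀ n z, (sublevelApprox ρ hρ r f n).1 z - {z | ρ z ≤ r}.indicator f.1 z =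
      if ρ z ≤ r then 0 else f.1 z * (1 - rampFun r n (ρ z)) := fun n z => by
    rw [sublevelApprox_apply]
    by_cases h : ρ z ≤ r
    · rw [indicator_of_mem (by exact h), rampFun_eq_zero n h, if_pos h]; ring
    · rw [indicator_of_notMem (by exact h), if_neg h, sub_zero]
  simp only [← Real.enorm_eq_ofReal_abs]
  rw [← lintegral_zero (μ := massMeasure T)]
  refine tendsto_lintegral_of_dominated_convergence (fun z => ‖f.1 z‖ₑ) (fun n => ?_)
    (fun n => ae_of_all _ fun z => ?_) (hT.lintegral_enorm_ne_top f) (ae_of_all _ fun z => ?_)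
  · exact ((Lipbs.continuous _).measurable.sub (measurable_indicator_sublevel hρ r f)).enorm
  · change ‖_‖ₑ ≤ _
    rw [hval]
    split_ifs
    · simp
    · rw [enorm_mul]
      refine mul_le_of_le_one_right zero_le ?_
      rw [Real.enorm_eq_ofReal_abs, ENNReal.ofReal_le_one]
      exact abs_le.2 ⟨by linarith [rampFun_le_one r n (ρ z)],
        by linarith [rampFun_nonneg r n (ρ z)]⟩
  · simp only [hval]
    by_cases h : ρ z ≤ r
    · simp [h]
    · refine tendsto_const_nhds.congr' ?_
      filter_upwards [rampFun_eventually_eq_one (not_le.1 h)] with n hn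
      simp [hn]

theorem IsTight.tendsto_restrict {T : FormFunction Z m} (hT : IsTight T) {ρ : Z → ℝ}
    (hρ : ∃ K : ℝ≥0, LipschitzWith K ρ) (r : ℝ) (f : Lipbs Z) (π : Fin m → Liploc Z) :
    Tendsto (fun n => T (sublevelApprox ρ hρ r f n) π) atTop
      (𝓝 (restrict T {z | ρ z ≤ r} f π)) :=
  hT.tendsto_extend (measurable_indicator_sublevel hρ r f) (hT.isApprox_sublevel hρ r f) π

theorem IsTight.isMetricFunctional_restrict {T : FormFunction Z m} (hT : IsTight T) {ρ : Z → ℝ}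
    (hρ : ∃ K : ℝ≥0, LipschitzWith K ρ) (r : ℝ) :
    IsMetricFunctional (restrict T {z | ρ z ≤ r}) where
  linear_left π := by
    refine ⟨fun f g => ?_, fun c f => ?_⟩
    · refine tendsto_nhds_unique (hT.tendsto_restrict hρ r (f + g) π) ?_
      simp only [sublevelApprox_add, hT.1.add_left]
      exact (hT.tendsto_restrict hρ r f π).add (hT.tendsto_restrict hρ r g π)
    · refine tendsto_nhds_unique (hT.tendsto_restrict hρ r (c • f) π) ?_
      simp only [sublevelApprox_smul, hT.1.smul_left]
      exact (hT.tendsto_restrict hρ r f π).const_mul c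
  linear_right f π i := by
    refine ⟨fun p q => ?_, fun c p => ?_⟩
    · refine tendsto_nhds_unique (hT.tendsto_restrict hρ r f _) ?_
      simp only [(hT.1.linear_right _ π i).map_add]
      exact (hT.tendsto_restrict hρ r f _).add (hT.tendsto_restrict hρ r f _)
    · refine tendsto_nhds_unique (hT.tendsto_restrict hρ r f _) ?_
      simp only [(hT.1.linear_right _ π i).map_smul]
      exact (hT.tendsto_restrict hρ r f _).const_mul c
  continuous f π πs h1 h2 := by
    -- All `πs j` and `π` share a Lipschitz bound `M` on the support of `f`, so the approximation of
    -- the restriction by `T (sublevelApprox ρ hρ r f k)` is uniform in `j`. An ε/3 argument then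
    -- transfers continuity from `T`.
    obtain ⟨K, hK⟩ := h2 _ f.2.2
    choose K' hK' using fun i => (π i).2 _ f.2.2
    set M : ℝ≥0 := K + ∑ i, K' i
    set P : ℝ≥0∞ := ((∏ _i : Fin m, M : ℝ≥0) : ℝ≥0∞)
    have hM : ∀ j i, LipschitzOnWith M (πs j i).1 (tsupport f.1) := fun j i =>
      (hK j i).weaken le_self_add
    have hM' : ∀ i, LipschitzOnWith M (π i).1 (tsupport f.1) := fun i => (hK' i).weaken
      ((Finset.single_le_sum (f := K') (fun _ _ => zero_le) (Finset.mem_univ i)).trans le_add_self)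
    have happ := hT.isApprox_sublevel hρ r f
    have key : ∀ (χ : Fin m → Liploc Z), (∀ i, LipschitzOnWith M (χ i).1 (tsupport f.1)) → ∀ k,
        edist (T (sublevelApprox ρ hρ r f k) χ) (restrict T {z | ρ z ≤ r} f χ) ≤
        P * ∫⁻ z, ‖(sublevelApprox ρ hρ r f k).1 z - {z | ρ z ≤ r}.indicator f.1 z‖ₑ
          ∂massMeasure T := fun χ hχ k => by
      rw [edist_eq_enorm_sub, ← hT.extend_lipbs]
      exact hT.enorm_extend_sub_le (Lipbs.continuous _).measurable
        (measurable_indicator_sublevel hρ r f) (isApprox_const _) happ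
        (fun _ => tsupport_sublevelApprox_subset hρ r f k)
        (tsupport_sublevelApprox_subset hρ r f) hχ
    have hlim := ENNReal.Tendsto.const_mul happ.tendsto_enorm
      (Or.inr (ENNReal.coe_ne_top (r := ∏ _i : Fin m, M)))
    rw [mul_zero] at hlim
    rw [EMetric.tendsto_atTop]
    intro ε hε
    have hε3 : 0 < ε / 3 := ENNReal.div_pos hε.ne' (by simp)
    obtain ⟨k, hk⟩ := (hlim.eventually (gt_mem_nhds hε3)).exists
    obtain ⟨N, hN⟩ := EMetric.tendsto_atTop.1
      (hT.1.continuous (sublevelApprox ρ hρ r f k) π πs h1 h2) _ hε3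
    refine ⟨N, fun j hj => ?_⟩
    calc edist (restrict T {z | ρ z ≤ r} f (πs j)) (restrict T {z | ρ z ≤ r} f π)
        ≤ edist (restrict T {z | ρ z ≤ r} f (πs j)) (T (sublevelApprox ρ hρ r f k) (πs j)) +
          edist (T (sublevelApprox ρ hρ r f k) (πs j)) (T (sublevelApprox ρ hρ r f k) π) +
          edist (T (sublevelApprox ρ hρ r f k) π) (restrict T {z | ρ z ≤ r} f π) :=
          edist_triangle4 _ _ _ _
      _ < ε / 3 + ε / 3 + ε / 3 := by
          refine ENNReal.add_lt_add (ENNReal.add_lt_add ?_ (hN j hj)) ((key π hM' k).trans_lt hk)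
          rw [edist_comm]
          exact (key _ (hM j) k).trans_lt hk
      _ = ε := ENNReal.add_thirds ε
  local' f π := by
    rintro ⟨i, δ, hδ, c, h⟩
    refine tendsto_nhds_unique (hT.tendsto_restrict hρ r f π) ?_
    have : ∀ n, T (sublevelApprox ρ hρ r f n) π = 0 := fun n =>
      hT.1.eq_zero_of_eq_const i c fun z hz =>
        h z (Metric.self_subset_cthickening _ (tsupport_sublevelApprox_subset hρ r f n hz))
    simp only [this]
    exact tendsto_const_nhds

theorem IsTight.isMetricFunctional_slice {T : FormFunction Z (m + 1)} (hT : IsTight T)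
    (hT' : IsTight (boundary T)) {ρ : Z → ℝ} (hρ : ∃ K : ℝ≥0, LipschitzWith K ρ) (r : ℝ) :
    IsMetricFunctional (slice T ρ r) :=
  (hT.isMetricFunctional_restrict hρ r).boundary.sub (hT'.isMetricFunctional_restrict hρ r)

/-- With c = 1 - γ_n∘ρ and σ a cutoff of `f`, the product rule reads T(σ, fc, π) = T(f, c, π) +
T(σc, f, π). The left side approximates (∂T)⌞{ρ ≤ r} and the last term ∂(T⌞{ρ ≤ r}), so their
difference is -T(f, c, π) = T(f, γ_n∘ρ, π). -/
theorem IsTight.tendsto_slice {T : FormFunction Z (m + 1)} (hT : IsTight T)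
    (hT' : IsTight (boundary T)) {ρ : Z → ℝ} (hρ : ∃ K : ℝ≥0, LipschitzWith K ρ) (r : ℝ)
    (f : Lipbs Z) (π : Fin m → Liploc Z) :
    Tendsto (fun n => T f (Fin.cons (ramp ρ hρ r n) π)) atTop (𝓝 (slice T ρ r f π)) := by
  have h1 := (hT.tendsto_restrict hρ r (cutoff f) (Fin.cons (Lipbs.toLiploc f) π)).sub
    (hT'.tendsto_restrict hρ r f π)
  refine h1.congr fun n => ?_
  set c : Liploc Z := Liploc.const Z 1 - ramp ρ hρ r n
  have e1 : boundary T (sublevelApprox ρ hρ r f n) π =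
      T (cutoff f) (Fin.cons (Liploc.mul (Lipbs.toLiploc f) c) π) :=
    hT.1.boundary_eq (fun z hz =>
      cutoff_eq_one f (tsupport_sublevelApprox_subset hρ r f n hz)) π
  have e2 : Lipbs.mul (cutoff f) (Lipbs.toLiploc f) = f := by
    ext z
    change (cutoff f).1 z * f.1 z = f.1 z
    by_cases hz : z ∈ tsupport f.1
    · rw [cutoff_eq_one f hz, one_mul]
    · rw [Lipbs.eq_zero f hz, mul_zero]
  have e3 : T f (Fin.cons c π) = T f (Fin.cons (Liploc.const Z 1) π) -
      T f (Fin.cons (ramp ρ hρ r n) π) := (hT.1.isLinearMap_cons f π).map_sub _ _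
  rw [e1, hT.product_rule, e2, e3, hT.1.cons_const]
  change T (Lipbs.mul (cutoff f) c) _ - _ = _
  ring

end

/-! ### Strip estimates, the coarea inequality, and measurability in the level -/

noncomputable section

section Strip

variable {Z : Type*} [MeasurableSpace Z]

/-- The strip `{r ≤ ρ ≤ r + 1 / (n + 1)}`. -/
def strip (ρ : Z → ℝ) (r : ℝ) (n : ℕ) : Set Z := {z | r ≤ ρ z ∧ ρ z ≤ r + 1 / (n + 1)}

theorem measurableSet_strip {ρ : Z → ℝ} (hρ : Measurable ρ) (r : ℝ) (n : ℕ) :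
    MeasurableSet (strip ρ r n) :=
  (measurableSet_le measurable_const hρ).inter (measurableSet_le hρ measurable_const)

theorem measurableSet_prod_strip {ρ : Z → ℝ} (hρ : Measurable ρ) (n : ℕ) :
    MeasurableSet {p : ℝ × Z | p.2 ∈ strip ρ p.1 n} :=
  (measurableSet_le measurable_fst (hρ.comp measurable_snd)).inter
    (measurableSet_le (hρ.comp measurable_snd) (measurable_fst.add_const _))

theorem measurable_measure_strip (μ : Measure Z) [SFinite μ] {ρ : Z → ℝ} (hρ : Measurable ρ)
    (V : Set Z) (n : ℕ) : Measurable fun r => μ (V ∩ strip ρ r n) := by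
  have := measurable_measure_prodMk_left (ν := μ.restrict V) (measurableSet_prod_strip hρ n)
  have h : (fun r => μ (V ∩ strip ρ r n)) =
      fun r => μ.restrict V (Prod.mk r ⁻¹' {p : ℝ × Z | p.2 ∈ strip ρ p.1 n}) := funext fun r => by
    rw [Measure.restrict_apply (measurable_prodMk_left (measurableSet_prod_strip hρ n)), inter_comm]
    rfl
  rw [h]
  exact this

/-- Fubini: a point z lies in the strip at r exactly when r is in [ρ z - 1/(n+1), ρ z]. This
interval has length 1/(n+1), and it meets (a, b) only if a < ρ z < b + 1/(n+1). -/
theorem lintegral_measure_strip_le (μ : Measure Z) [SFinite μ] {ρ : Z → ℝ} (hρ : Measurable ρ)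
    {V : Set Z} (n : ℕ) (a b : ℝ) :
    ∫⁻ r in Ioo a b, ((n + 1 : ℝ≥0) : ℝ≥0∞) * μ (V ∩ strip ρ r n) ≤
      μ (V ∩ {z | a < ρ z ∧ ρ z < b + 1 / (n + 1)}) := by
  have hm := measurableSet_prod_strip hρ n
  have hE : MeasurableSet {z | a < ρ z ∧ ρ z < b + 1 / (n + 1)} :=
    (measurableSet_lt measurable_const hρ).inter (measurableSet_lt hρ measurable_const)
  have h1 : ∀ r, μ (V ∩ strip ρ r n) =
      ∫⁻ z in V, {p : ℝ × Z | p.2 ∈ strip ρ p.1 n}.indicator (fun _ => 1) (r, z) ∂μ := fun r => by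
    have : (fun z => {p : ℝ × Z | p.2 ∈ strip ρ p.1 n}.indicator (fun _ => (1 : ℝ≥0∞)) (r, z)) =
      (strip ρ r n).indicator 1 := rfl
    rw [this, lintegral_indicator_one (measurableSet_strip hρ r n),
      Measure.restrict_apply (measurableSet_strip hρ r n), inter_comm]
  rw [lintegral_const_mul _ (measurable_measure_strip μ hρ V n)]
  simp only [h1]
  have hae : AEMeasurable (Function.uncurry fun (r : ℝ) (z : Z) =>
      {p : ℝ × Z | p.2 ∈ strip ρ p.1 n}.indicator (fun _ => (1 : ℝ≥0∞)) (r, z))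
      ((volume.restrict (Ioo a b)).prod (μ.restrict V)) :=
    (measurable_const.indicator hm).aemeasurable
  rw [lintegral_lintegral_swap hae,
    ← lintegral_const_mul' _ _ ENNReal.coe_ne_top]
  calc _ ≤ ∫⁻ z in V, {z | a < ρ z ∧ ρ z < b + 1 / (n + 1)}.indicator 1 z ∂μ := by
        refine lintegral_mono fun z => ?_
        have h2 : (fun r => {p : ℝ × Z | p.2 ∈ strip ρ p.1 n}.indicator
            (fun _ => (1 : ℝ≥0∞)) (r, z)) =
            (Icc (ρ z - 1 / (n + 1)) (ρ z)).indicator 1 := by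
          ext r
          refine indicator_eq_indicator (Iff.intro ?_ ?_) rfl
          · rintro ⟨h1, h2⟩
            exact ⟨by linarith, h1⟩
          · rintro ⟨h1, h2⟩
            exact ⟨h2, by linarith⟩
        rw [h2, lintegral_indicator_one measurableSet_Icc, Measure.restrict_apply measurableSet_Icc]
        by_cases hz : a < ρ z ∧ ρ z < b + 1 / (n + 1)
        · rw [indicator_of_mem (by exact hz)]
          calc _ ≤ ((n + 1 : ℝ≥0) : ℝ≥0∞) * volume (Icc (ρ z - 1 / ((n : ℝ) + 1)) (ρ z)) := by
                gcongr
                exact inter_subset_left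
            _ = 1 := by
                rw [Real.volume_Icc, sub_sub_cancel, ← ENNReal.ofReal_coe_nnreal,
                  ← ENNReal.ofReal_mul (NNReal.coe_nonneg _)]
                push_cast
                rw [mul_one_div_cancel (by positivity), ENNReal.ofReal_one]
            _ = _ := rfl
        · have : Icc (ρ z - 1 / ((n : ℝ) + 1)) (ρ z) ∩ Ioo a b = ∅ :=
            eq_empty_of_forall_notMem fun r hr => hz
              ⟨hr.2.1.trans_le hr.1.2, by linarith [hr.1.1, hr.2.2]⟩
          rw [this, measure_empty, mul_zero]
          exact zero_le
    _ = _ := by rw [lintegral_indicator_one hE, Measure.restrict_apply hE, inter_comm]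

theorem iUnion_Ioo_sub_one_div (a b : ℝ) : ⋃ k : ℕ, Ioo a (b - 1 / (k + 1)) = Ioo a b := by
  ext x
  simp only [mem_iUnion, mem_Ioo]
  constructor
  · rintro ⟨k, h1, h2⟩
    have : (0 : ℝ) < 1 / (k + 1) := by positivity
    exact ⟨h1, by linarith⟩
  · rintro ⟨h1, h2⟩
    obtain ⟨k, hk⟩ := exists_nat_one_div_lt (sub_pos.2 h2)
    exact ⟨k, h1, by linarith⟩

end Strip

variable {Z : Type*} [MetricSpace Z] {m : ℕ} [MeasurableSpace Z] [BorelSpace Z]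

/-- Strict locality discards the parts of `f` supported where the ramp is constant: it is 0 on {ρ ≤
r} and 1 on {ρ ≥ r + 1/(n+1)}. Cutoffs `a j`, `b j` exhaust the complement of the strip, and the
remainder `f' j` converges to f restricted to the strip. -/
theorem IsTight.enorm_ramp_le {T : FormFunction Z (m + 1)} (hT : IsTight T) {ρ : Z → ℝ}
    (hρ : ∃ K : ℝ≥0, LipschitzWith K ρ) (r : ℝ) (n : ℕ) (f : Lipbs Z) {π : Fin m → Liploc Z}
    (hπ : ∀ i, LipschitzWith 1 (π i).1) :
    ‖T f (Fin.cons (ramp ρ hρ r n) π)‖ₑ ≤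
      ((n + 1) * lipConst ρ : ℝ≥0) * ∫⁻ z in strip ρ r n, ‖f.1 z‖ₑ ∂massMeasure T := by
  have hc : Continuous ρ := hρ.choose_spec.continuous
  have hρ' : ∃ K : ℝ≥0, LipschitzWith K fun z => -ρ z := hρ.imp fun _ h => h.neg
  -- Reversing the sign of ρ produces a cutoff supported in {ρ ≤ r}.
  let a : ℕ → Liploc Z := ramp (fun z => -ρ z) hρ' (-r)
  let b : ℕ → Liploc Z := ramp ρ hρ (r + 1 / (n + 1))
  let p : Fin (m + 1) → Liploc Z := Fin.cons (ramp ρ hρ r n) π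
  have hp0 : ∀ z, (p 0).1 z = rampFun r n (ρ z) := fun z => rfl
  let f' : ℕ → Lipbs Z := fun j => Lipbs.mul f (Liploc.const Z 1 - a j - b j)
  have hf' : ∀ j z, (f' j).1 z =
      f.1 z * (1 - rampFun (-r) j (-ρ z) - rampFun (r + 1 / (n + 1)) j (ρ z)) := fun j z => rfl
  have hsum : ∀ j, f = Lipbs.mul f (a j) + Lipbs.mul f (b j) + f' j := fun j => by
    ext z
    change f.1 z = f.1 z * rampFun (-r) j (-ρ z) + f.1 z * rampFun (r + 1 / (n + 1)) j (ρ z) +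
      f.1 z * (1 - rampFun (-r) j (-ρ z) - rampFun (r + 1 / (n + 1)) j (ρ z))
    ring
  have ha : ∀ j, T (Lipbs.mul f (a j)) p = 0 := fun j => by
    refine hT.1.eq_zero_of_eq_const 0 0 fun z hz => ?_
    have hcl : IsClosed {z | ρ z ≤ r} := isClosed_le hc continuous_const
    have hz' : ρ z ≤ r := tsupport_subset_of_isClosed hcl
      (fun z hz => rampFun_eq_zero j (neg_le_neg (not_le.1 hz).le))
      (tsupport_mul_right_subset f (a j) hz)
    rw [hp0]
    exact rampFun_eq_zero n hz'
  have hb : ∀ j, T (Lipbs.mul f (b j)) p = 0 := fun j => by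
    refine hT.1.eq_zero_of_eq_const 0 1 fun z hz => ?_
    have hcl : IsClosed {z | r + 1 / ((n : ℝ) + 1) ≤ ρ z} := isClosed_le continuous_const hc
    have hz' : r + 1 / ((n : ℝ) + 1) ≤ ρ z := tsupport_subset_of_isClosed hcl
      (fun z hz => rampFun_eq_zero j (not_le.1 hz).le) (tsupport_mul_right_subset f (b j) hz)
    rw [hp0]
    exact rampFun_eq_one hz'
  have key : ∀ j, ‖T f p‖ₑ ≤ ((n + 1) * lipConst ρ : ℝ≥0) *
      ∫⁻ z, ‖(f' j).1 z‖ₑ ∂massMeasure T := fun j => by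
    have h1 : T f p = T (f' j) p := by
      conv_lhs => rw [hsum j]
      rw [hT.1.add_left, hT.1.add_left, ha, hb, zero_add, zero_add]
    rw [h1]
    have h2 := hT.enorm_le (f' j) p (Fin.cons ((n + 1) * lipConst ρ) fun _ => 1) (fun i => by
      refine Fin.cases ?_ (fun i => ?_) i
      · exact (ramp_lipschitz hρ r n).lipschitzOnWith
      · exact (hπ i).lipschitzOnWith)
    rw [Fin.prod_cons, Finset.prod_const_one, mul_one] at h2
    exact h2
  have hlim : Tendsto (fun j => ((n + 1) * lipConst ρ : ℝ≥0) *
      ∫⁻ z, ‖(f' j).1 z‖ₑ ∂massMeasure T) atTop (𝓝 (((n + 1) * lipConst ρ : ℝ≥0) *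
      ∫⁻ z in strip ρ r n, ‖f.1 z‖ₑ ∂massMeasure T)) := by
    refine ENNReal.Tendsto.const_mul ?_ (Or.inr ENNReal.coe_ne_top)
    rw [← lintegral_indicator (measurableSet_strip hc.measurable r n)]
    refine tendsto_lintegral_of_dominated_convergence (fun z => ‖f.1 z‖ₑ)
      (fun j => Lipbs.measurable_enorm _) (fun j => ae_of_all _ fun z => ?_)
      (hT.lintegral_enorm_ne_top f) (ae_of_all _ fun z => ?_)
    · change ‖(f' j).1 z‖ₑ ≤ ‖f.1 z‖ₑ
      rw [hf', enorm_mul]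
      refine mul_le_of_le_one_right zero_le ?_
      rw [Real.enorm_eq_ofReal_abs, ENNReal.ofReal_le_one]
      have a0 := rampFun_nonneg (-r) j (-ρ z)
      have b0 := rampFun_nonneg (r + 1 / (n + 1)) j (ρ z)
      have a1 := rampFun_le_one (-r) j (-ρ z)
      have b1 := rampFun_le_one (r + 1 / (n + 1)) j (ρ z)
      exact abs_le.2 ⟨by linarith, by linarith⟩
    · have hn : (0 : ℝ) < 1 / (n + 1) := by positivity
      refine tendsto_const_nhds.congr' ?_
      by_cases h1 : r ≤ ρ z
      · by_cases h2 : ρ z ≤ r + 1 / (n + 1)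
        · refine Eventually.of_forall fun j => ?_
          dsimp only
          rw [indicator_of_mem (show z ∈ strip ρ r n from ⟨h1, h2⟩), hf',
            rampFun_eq_zero j (neg_le_neg h1), rampFun_eq_zero j h2]
          simp
        · filter_upwards [rampFun_eventually_eq_one (not_le.1 h2)] with j hj
          rw [indicator_of_notMem (fun h : z ∈ strip ρ r n => h2 h.2), hf', hj,
            rampFun_eq_zero j (neg_le_neg h1)]
          simp
      · have h1' := not_le.1 h1
        filter_upwards [rampFun_eventually_eq_one (neg_lt_neg h1')] with j hj
        rw [indicator_of_notMem (fun h : z ∈ strip ρ r n => h1 h.1), hf', hj,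
          rampFun_eq_zero j (by linarith)]
        simp
  exact ge_of_tendsto' hlim key

/-- The mass of a slice is bounded by the lower density of the mass of the current. -/
theorem IsTight.massIn_slice_le {T : FormFunction Z (m + 1)} (hT : IsTight T)
    (hT' : IsTight (boundary T)) {ρ : Z → ℝ} (hρ : ∃ K : ℝ≥0, LipschitzWith K ρ) (r : ℝ)
    {V : Set Z} (hV : MeasurableSet V) :
    massIn (slice T ρ r) V ≤ liminf (fun n : ℕ => ((n + 1) * lipConst ρ : ℝ≥0) *
      massMeasure T (V ∩ strip ρ r n)) atTop := by
  refine massIn_le fun k f π hf => ?_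
  have hlim : Tendsto (fun n => ENNReal.ofReal
      (∑ l, T (f l) (Fin.cons (ramp ρ hρ r n) (π l)))) atTop
      (𝓝 (ENNReal.ofReal (∑ l, slice T ρ r (f l) (π l)))) :=
    ENNReal.tendsto_ofReal (tendsto_finsetSum _ fun l _ => hT.tendsto_slice hT' hρ r (f l) (π l))
  rw [← hlim.liminf_eq]
  -- For fixed `n` the ramp estimates are summed under one integral over the strip, where the sum of
  -- the |f l| is at most the indicator of `V`.
  refine liminf_le_liminf (Eventually.of_forall fun n => ?_)
  calc ENNReal.ofReal (∑ l, T (f l) (Fin.cons (ramp ρ hρ r n) (π l)))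
      ≤ ‖∑ l, T (f l) (Fin.cons (ramp ρ hρ r n) (π l))‖ₑ := by
        rw [Real.enorm_eq_ofReal_abs]
        exact ENNReal.ofReal_le_ofReal (le_abs_self _)
    _ ≤ ∑ l, ‖T (f l) (Fin.cons (ramp ρ hρ r n) (π l))‖ₑ := enorm_sum_le _ _
    _ ≤ ∑ l, ((n + 1) * lipConst ρ : ℝ≥0) * ∫⁻ z in strip ρ r n, ‖(f l).1 z‖ₑ ∂massMeasure T :=
        Finset.sum_le_sum fun l _ => hT.enorm_ramp_le hρ r n (f l) (hf.lipschitz l)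
    _ = ((n + 1) * lipConst ρ : ℝ≥0) *
        ∫⁻ z in strip ρ r n, ∑ l, ‖(f l).1 z‖ₑ ∂massMeasure T := by
        rw [← Finset.mul_sum, lintegral_finsetSum _ fun l _ => Lipbs.measurable_enorm (f l)]
    _ ≤ ((n + 1) * lipConst ρ : ℝ≥0) *
        ∫⁻ z in strip ρ r n, V.indicator 1 z ∂massMeasure T := by
        gcongr with z
        by_cases hz : z ∈ V
        · rw [indicator_of_mem hz, Pi.one_apply]
          have := ENNReal.ofReal_le_ofReal (hf.sum_le_one z)
          rw [ENNReal.ofReal_sum_of_nonneg fun _ _ => abs_nonneg _, ENNReal.ofReal_one] at this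
          simpa only [Real.enorm_eq_ofReal_abs] using this
        · have : ∀ l, (f l).1 z = 0 := fun l =>
            Lipbs.eq_zero _ fun h => hz (hf.support_subset l h)
          simp [this]
    _ = ((n + 1) * lipConst ρ : ℝ≥0) * massMeasure T (V ∩ strip ρ r n) := by
        rw [lintegral_indicator_one hV, Measure.restrict_apply hV]

theorem IsTight.massIn_slice_eq_zero {T : FormFunction Z (m + 1)} (hT : IsTight T)
    (hT' : IsTight (boundary T)) {ρ : Z → ℝ} (hρ : ∃ K : ℝ≥0, LipschitzWith K ρ) (r : ℝ)
    {V : Set Z} (hV : MeasurableSet V)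
    (h : ∀ᶠ n in atTop, massMeasure T (V ∩ strip ρ r n) = 0) :
    massIn (slice T ρ r) V = 0 := by
  refine le_antisymm ((hT.massIn_slice_le hT' hρ r hV).trans ?_) zero_le
  have : Tendsto (fun n : ℕ => ((n + 1) * lipConst ρ : ℝ≥0) *
      massMeasure T (V ∩ strip ρ r n)) atTop (𝓝 0) :=
    tendsto_const_nhds.congr' (h.mono fun n hn => by dsimp only; rw [hn, mul_zero])
  exact this.liminf_eq.le

theorem IsTight.massIn_slice_eq_zero_of_lt_abs {T : FormFunction Z (m + 1)} (hT : IsTight T)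
    (hT' : IsTight (boundary T)) {ρ : Z → ℝ} (hρ : ∃ K : ℝ≥0, LipschitzWith K ρ) (r : ℝ)
    {V : Set Z} (hV : MeasurableSet V) {δ : ℝ} (hδ : 0 < δ) (h : ∀ z ∈ V, δ < |ρ z - r|) :
    massIn (slice T ρ r) V = 0 := by
  refine hT.massIn_slice_eq_zero hT' hρ r hV ?_
  filter_upwards [(tendsto_one_div_add_atTop_nhds_zero_nat (𝕜 := ℝ)).eventually (gt_mem_nhds hδ)]
    with n hn
  have : V ∩ strip ρ r n = ∅ := eq_empty_of_forall_notMem fun z hz => by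
    have h1 := h z hz.1
    rw [abs_of_nonneg (by linarith [hz.2.1])] at h1
    linarith [hz.2.2]
  rw [this, measure_empty]

/-- The coarea inequality for open sets. -/
theorem IsTight.lintegral_massIn_slice_le {T : FormFunction Z (m + 1)} (hT : IsTight T)
    (hT' : IsTight (boundary T)) {ρ : Z → ℝ} (hρ : ∃ K : ℝ≥0, LipschitzWith K ρ)
    {V : Set Z} (hV : MeasurableSet V) (a b : ℝ) :
    ∫⁻ r in Ioo a b, massIn (slice T ρ r) V ≤
      lipConst ρ * massMeasure T (V ∩ {z | a < ρ z ∧ ρ z < b}) := by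
  have hm : Measurable ρ := hρ.choose_spec.continuous.measurable
  have := hT.sigmaFinite
  -- Strips overhang the interval of levels by 1/(n+1). Stopping at b - 1/(k+1) keeps them below b
  -- for large n; Fatou is applied for each k, and monotone convergence recovers (a, b).
  rw [← iUnion_Ioo_sub_one_div a b, setLIntegral_iUnion_of_directed]
  swap
  · refine (monotone_nat_of_le_succ fun k => Ioo_subset_Ioo_right ?_).directed_le
    have : 1 / (((k + 1 : ℕ) : ℝ) + 1) ≤ 1 / ((k : ℝ) + 1) := by
      gcongr
      simp
    linarith
  refine iSup_le fun k => ?_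
  calc _ ≤ ∫⁻ r in Ioo a (b - 1 / (k + 1)), liminf (fun n : ℕ =>
          ((n + 1) * lipConst ρ : ℝ≥0) * massMeasure T (V ∩ strip ρ r n)) atTop :=
        lintegral_mono fun r => hT.massIn_slice_le hT' hρ r hV
    _ ≤ liminf (fun n : ℕ => ∫⁻ r in Ioo a (b - 1 / (k + 1)),
          ((n + 1) * lipConst ρ : ℝ≥0) * massMeasure T (V ∩ strip ρ r n)) atTop :=
        lintegral_liminf_le fun n => (measurable_measure_strip _ hm V n).const_mul _
    _ ≤ _ := by
        refine liminf_le_of_frequently_le' (Eventually.frequently ?_)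
        have hk : (0 : ℝ) < 1 / (k + 1) := by positivity
        filter_upwards [(tendsto_one_div_add_atTop_nhds_zero_nat (𝕜 := ℝ)).eventually
          (gt_mem_nhds hk)] with n hn
        have e : ∀ r, (((n + 1) * lipConst ρ : ℝ≥0) : ℝ≥0∞) * massMeasure T (V ∩ strip ρ r n) =
            lipConst ρ * (((n + 1 : ℝ≥0) : ℝ≥0∞) * massMeasure T (V ∩ strip ρ r n)) := fun r => by
          rw [ENNReal.coe_mul, mul_assoc, mul_left_comm]
        simp only [e]
        rw [lintegral_const_mul' _ _ ENNReal.coe_ne_top]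
        gcongr
        refine (lintegral_measure_strip_le _ hm n a _).trans (measure_mono ?_)
        exact inter_subset_inter_right _ fun z hz => ⟨hz.1, by linarith [hz.2]⟩

theorem IsTight.lintegral_massIn_slice_univ_le {T : FormFunction Z (m + 1)} (hT : IsTight T)
    (hT' : IsTight (boundary T)) {ρ : Z → ℝ} (hρ : ∃ K : ℝ≥0, LipschitzWith K ρ)
    {V : Set Z} (hV : MeasurableSet V) :
    ∫⁻ r, massIn (slice T ρ r) V ≤ lipConst ρ * massMeasure T V := by
  have hu : ⋃ k : ℕ, Ioo (-(k : ℝ)) k = univ := eq_univ_of_forall fun x => by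
    obtain ⟨k, hk⟩ := exists_nat_gt |x|
    exact mem_iUnion.2 ⟨k, abs_lt.1 hk⟩
  rw [← setLIntegral_univ, ← hu, setLIntegral_iUnion_of_directed]
  · refine iSup_le fun k => (hT.lintegral_massIn_slice_le hT' hρ hV _ _).trans ?_
    gcongr
    exact inter_subset_left
  · refine (monotone_nat_of_le_succ fun k => Ioo_subset_Ioo ?_ ?_).directed_le
    · push_cast; linarith
    · push_cast; linarith

/-- As s decreases to r, the sets {ρ ≤ s} shrink to {ρ ≤ r}, so the indicators converge everywhere.
From the left one would only reach {ρ < r}. -/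
theorem IsTight.tendsto_restrict_nhdsGT {T : FormFunction Z m} (hT : IsTight T) {ρ : Z → ℝ}
    (hρ : ∃ K : ℝ≥0, LipschitzWith K ρ) (r : ℝ) (f : Lipbs Z) (π : Fin m → Liploc Z) :
    Tendsto (fun s => restrict T {z | ρ z ≤ s} f π) (𝓝[>] r)
      (𝓝 (restrict T {z | ρ z ≤ r} f π)) := by
  choose L hL using fun i => (π i).2 _ f.2.2
  have key : ∀ s, edist (restrict T {z | ρ z ≤ s} f π) (restrict T {z | ρ z ≤ r} f π) ≤
      ((∏ i, L i : ℝ≥0) : ℝ≥0∞) * ∫⁻ z, ‖{z | ρ z ≤ s}.indicator f.1 z -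
        {z | ρ z ≤ r}.indicator f.1 z‖ₑ ∂massMeasure T := fun s => by
    rw [edist_eq_enorm_sub]
    exact hT.enorm_extend_sub_le (measurable_indicator_sublevel hρ s f)
      (measurable_indicator_sublevel hρ r f) (hT.isApprox_sublevel hρ s f)
      (hT.isApprox_sublevel hρ r f) (tsupport_sublevelApprox_subset hρ s f)
      (tsupport_sublevelApprox_subset hρ r f) hL
  have hlim : Tendsto (fun s => ∫⁻ z, ‖{z | ρ z ≤ s}.indicator f.1 z -
        {z | ρ z ≤ r}.indicator f.1 z‖ₑ ∂massMeasure T) (𝓝[>] r)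
        (𝓝 (∫⁻ _, 0 ∂massMeasure T)) := by
    refine tendsto_lintegral_filter_of_dominated_convergence (fun z => ‖f.1 z‖ₑ)
      (Eventually.of_forall fun s => ((measurable_indicator_sublevel hρ s f).sub
        (measurable_indicator_sublevel hρ r f)).enorm)
      (eventually_mem_nhdsWithin.mono fun s hs => ae_of_all _ fun z => ?_)
      (hT.lintegral_enorm_ne_top f) (ae_of_all _ fun z => ?_)
    · have hs : r < s := hs
      by_cases h1 : ρ z ≤ r
      · rw [indicator_of_mem (by exact h1.trans hs.le), indicator_of_mem (by exact h1)]
        simp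
      · rw [indicator_of_notMem (s := {z | ρ z ≤ r}) (by exact h1), sub_zero]
        exact enorm_indicator_le_enorm_self _ _
    · refine tendsto_const_nhds.congr' ?_
      by_cases h1 : ρ z ≤ r
      · filter_upwards [eventually_mem_nhdsWithin] with s hs
        have hs : r < s := hs
        rw [indicator_of_mem (by exact h1.trans hs.le), indicator_of_mem (by exact h1)]
        simp
      · filter_upwards [nhdsWithin_le_nhds (gt_mem_nhds (not_le.1 h1))] with s hs
        rw [indicator_of_notMem (by exact not_le.2 hs), indicator_of_notMem (by exact h1)]
        simp
  have hlim' := ENNReal.Tendsto.const_mul hlim (Or.inr (ENNReal.coe_ne_top (r := ∏ i, L i)))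
  rw [lintegral_zero, mul_zero] at hlim'
  exact tendsto_iff_edist_tendsto_0.2
    (tendsto_of_tendsto_of_tendsto_of_le_of_le tendsto_const_nhds hlim' (fun _ => zero_le) key)

theorem IsTight.tendsto_slice_nhdsGT {T : FormFunction Z (m + 1)} (hT : IsTight T)
    (hT' : IsTight (boundary T)) {ρ : Z → ℝ} (hρ : ∃ K : ℝ≥0, LipschitzWith K ρ) (r : ℝ)
    (f : Lipbs Z) (π : Fin m → Liploc Z) :
    Tendsto (fun s => slice T ρ s f π) (𝓝[>] r) (𝓝 (slice T ρ r f π)) :=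
  (hT.tendsto_restrict_nhdsGT hρ r _ _).sub (hT'.tendsto_restrict_nhdsGT hρ r f π)

/-- The supremum is over an uncountable family, but every member is right-continuous in `r`. Hence a
strict superlevel set contains a right neighbourhood of each of its points, and such subsets of ℝ
are Borel. -/
theorem IsTight.measurable_massIn_slice {T : FormFunction Z (m + 1)} (hT : IsTight T)
    (hT' : IsTight (boundary T)) {ρ : Z → ℝ} (hρ : ∃ K : ℝ≥0, LipschitzWith K ρ) (V : Set Z) :
    Measurable fun r => massIn (slice T ρ r) V := by
  refine measurable_of_Ioi fun c => MeasurableSet.of_mem_nhdsGT fun r hr => ?_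
  have hr : c < massIn (slice T ρ r) V := hr
  simp only [massIn, lt_iSup_iff] at hr
  obtain ⟨n, f, π, hf, hlt⟩ := hr
  have hlim : Tendsto (fun s => ENNReal.ofReal (∑ l, slice T ρ s (f l) (π l))) (𝓝[>] r)
      (𝓝 (ENNReal.ofReal (∑ l, slice T ρ r (f l) (π l)))) :=
    ENNReal.tendsto_ofReal (tendsto_finsetSum _ fun l _ =>
      hT.tendsto_slice_nhdsGT hT' hρ r (f l) (π l))
  filter_upwards [hlim.eventually (lt_mem_nhds hlt)] with s hs
  exact hs.trans_le hf.le_massIn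

end

/-! ### Normality and support of slices, and the coarea inequality for Borel sets -/

noncomputable section

variable {Z : Type*} [MetricSpace Z] {m : ℕ}

theorem massIn_zero (V : Set Z) : massIn (0 : FormFunction Z m) V = 0 :=
  le_antisymm (massIn_le fun n f π _ => by simp) zero_le

theorem isTight_zero : IsTight (0 : FormFunction Z m) where
  isMetricFunctional :=
    { linear_left := fun _ => ⟨fun _ _ => (add_zero 0).symm, fun c _ => (smul_zero c).symm⟩
      linear_right := fun _ _ _ => ⟨fun _ _ => (add_zero 0).symm, fun c _ => (smul_zero c).symm⟩
      continuous := fun _ _ _ _ _ => tendsto_const_nhds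
      local' := fun _ _ _ => rfl }
  tight U _ _ ε hε := ⟨∅, isCompact_empty, by simp [massIn_zero], by simpa [massIn_zero] using hε⟩

theorem IsMetricFunctional.massIn_neg_le {T : FormFunction Z m} (hT : IsMetricFunctional T)
    (V : Set Z) : massIn (-T) V ≤ massIn T V := by
  refine massIn_le fun n f π hf => ?_
  have hf' : IsMassFamily V (fun l => -f l) π := by
    refine ⟨hf.lipschitz, fun l => ?_, fun z => ?_⟩
    · have h : tsupport (-f l).1 = tsupport (f l).1 := by
        change tsupport (-(f l).1) = _
        rw [tsupport, tsupport, Function.support_neg]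
      rw [h]
      exact hf.support_subset l
    · refine (Finset.sum_le_sum fun l _ => ?_).trans (hf.sum_le_one z)
      exact (abs_neg ((f l).1 z)).le
  refine le_trans (le_of_eq ?_) hf'.le_massIn
  congr 2 with l
  rw [hT.neg_left]
  rfl

theorem IsTight.neg {T : FormFunction Z m} (hT : IsTight T) : IsTight (-T) where
  isMetricFunctional := by
    rw [← zero_sub]
    exact isTight_zero.1.sub hT.1
  tight U hU hB ε hε := by
    obtain ⟨C, hC, h1, h2⟩ := hT.tight U hU hB ε hε
    exact ⟨C, hC, (hT.1.massIn_neg_le _).trans_lt h1, (hT.1.massIn_neg_le _).trans_lt h2⟩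

variable [MeasurableSpace Z] [BorelSpace Z]

theorem restrict_zero {ρ : Z → ℝ} (hρ : ∃ K : ℝ≥0, LipschitzWith K ρ) (r : ℝ) :
    restrict (0 : FormFunction Z m) {z | ρ z ≤ r} = 0 := by
  ext f π
  exact tendsto_nhds_unique (isTight_zero.tendsto_restrict hρ r f π) tendsto_const_nhds

/-- As ∂∂ = 0, both sides reduce to -∂((∂T)⌞{ρ ≤ r}). -/
theorem IsTight.boundary_slice {T : FormFunction Z (m + 2)} (hT : IsTight T) {ρ : Z → ℝ}
    (hρ : ∃ K : ℝ≥0, LipschitzWith K ρ) (r : ℝ) :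
    boundary (slice T ρ r) = -slice (boundary T) ρ r := by
  have h1 : boundary (slice T ρ r) = boundary (boundary (restrict T {z | ρ z ≤ r})) -
      boundary (restrict (boundary T) {z | ρ z ≤ r}) := rfl
  rw [h1, (hT.isMetricFunctional_restrict hρ r).boundary_boundary, slice,
    hT.1.boundary_boundary, restrict_zero hρ, sub_zero, zero_sub]

/-- Take compact `C n k` with M_{U n \ C n k}(T) < 1/(k+1). The slice masses there have integral at
most Lip(ρ)/(k+1), so their infimum over `k` has integral zero and vanishes for almost every `r`.
Countably many `U n` suffice, because every bounded open set lies in one of them. -/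
theorem IsTight.ae_isTight_slice {T : FormFunction Z (m + 1)} (hT : IsTight T)
    (hT' : IsTight (boundary T)) {ρ : Z → ℝ} (hρ : ∃ K : ℝ≥0, LipschitzWith K ρ) :
    ∀ᵐ r, IsTight (slice T ρ r) := by
  obtain ⟨U, -, hUo, hUb, -, hUex⟩ := exists_exhaustion Z
  have hC : ∀ n k : ℕ, ∃ C : Set Z, IsCompact C ∧ massIn T (U n) < ∞ ∧
      massIn T (U n \ C) < ((k : ℝ≥0∞) + 1)⁻¹ := fun n k =>
    hT.tight (U n) (hUo n) (hUb n) _ (by simp)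
  choose C hC hfin hlt using hC
  have hopen : ∀ n k, IsOpen (U n \ C n k) := fun n k => (hUo n).sdiff (hC n k).isClosed
  have h1 : ∀ᵐ r, ∀ n, massIn (slice T ρ r) (U n) < ∞ := ae_all_iff.2 fun n => by
    refine ae_lt_top (hT.measurable_massIn_slice hT' hρ _) ((hT.lintegral_massIn_slice_univ_le hT' hρ
      (hUo n).measurableSet).trans_lt ?_).ne
    exact ENNReal.mul_lt_top ENNReal.coe_lt_top (hT.massMeasure_lt_top (hUb n))
  have h2 : ∀ᵐ r, ∀ n, ⨅ k, massIn (slice T ρ r) (U n \ C n k) = 0 := ae_all_iff.2 fun n => by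
    have hm : Measurable fun r => ⨅ k, massIn (slice T ρ r) (U n \ C n k) :=
      Measurable.iInf fun k => hT.measurable_massIn_slice hT' hρ _
    refine (lintegral_eq_zero_iff hm).1 (le_antisymm ?_ zero_le)
    have hb : ∀ k : ℕ, ∫⁻ r, ⨅ k, massIn (slice T ρ r) (U n \ C n k) ≤
        lipConst ρ * ((k : ℝ≥0∞) + 1)⁻¹ := fun k => by
      refine (lintegral_mono fun r => iInf_le _ k).trans ((hT.lintegral_massIn_slice_univ_le hT' hρ
        (hopen n k).measurableSet).trans ?_)
      rw [hT.massMeasure_of_isOpen (hopen n k)]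
      gcongr
      exact (hlt n k).le
    have hlim : Tendsto (fun k : ℕ => (lipConst ρ : ℝ≥0∞) * ((k : ℝ≥0∞) + 1)⁻¹) atTop
        (𝓝 (lipConst ρ * 0)) := by
      refine ENNReal.Tendsto.const_mul ?_ (Or.inr ENNReal.coe_ne_top)
      have := (tendsto_add_atTop_iff_nat 1).2 ENNReal.tendsto_inv_nat_nhds_zero
      simpa using this
    rw [mul_zero] at hlim
    exact ge_of_tendsto' hlim hb
  filter_upwards [h1, h2] with r hr1 hr2
  refine ⟨hT.isMetricFunctional_slice hT' hρ r, fun V _ hVb ε hε => ?_⟩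
  obtain ⟨n, hn⟩ := hUex V hVb
  have hε' : ⨅ k, massIn (slice T ρ r) (U n \ C n k) < ε := by rwa [hr2 n]
  obtain ⟨k, hk⟩ := iInf_lt_iff.1 hε'
  exact ⟨C n k, hC n k, (massIn_mono _ hn).trans_lt (hr1 n),
    (massIn_mono _ (sdiff_subset_sdiff_left hn)).trans_lt hk⟩

/-- Both inclusions hold for every `r` by the liminf bound: a small neighbourhood of a point off {ρ
= r} eventually misses the strips, and a ‖T‖-null ball meets them in null sets. -/
theorem IsTight.spt_slice_subset {T : FormFunction Z (m + 1)} (hT : IsTight T)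
    (hT' : IsTight (boundary T)) {ρ : Z → ℝ} (hρ : ∃ K : ℝ≥0, LipschitzWith K ρ) (r : ℝ) :
    spt (slice T ρ r) ⊆ {z | ρ z = r} ∩ spt T := by
  have key : ∀ z V, IsOpen V → z ∈ V → massIn (slice T ρ r) V = 0 → z ∉ spt (slice T ρ r) := by
    intro z V hV hzV h0 hz
    obtain ⟨s, hs, hsV⟩ := Metric.nhds_basis_closedBall.mem_iff.1 (hV.mem_nhds hzV)
    exact absurd ((mass_le_massIn _ hV hsV).trans h0.le) (not_le.2 (hz s hs))
  refine fun z hz => ⟨by_contra fun hne => ?_, fun s hs => pos_iff_ne_zero.2 fun h0 => ?_⟩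
  · have hpos : 0 < |ρ z - r| := abs_pos.2 (sub_ne_zero.2 hne)
    have hV : IsOpen {y | |ρ z - r| / 2 < |ρ y - r|} :=
      isOpen_lt continuous_const (hρ.choose_spec.continuous.sub continuous_const).abs
    exact key z _ hV (half_lt_self hpos) (hT.massIn_slice_eq_zero_of_lt_abs hT' hρ r
      hV.measurableSet (half_pos hpos) fun y hy => hy) hz
  · have hV : massMeasure T (Metric.ball z s) = 0 := by
      rw [hT.massMeasure_apply Metric.isOpen_ball.measurableSet]
      exact le_antisymm ((mass_mono T Metric.ball_subset_closedBall).trans h0.le) zero_le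
    exact key z _ Metric.isOpen_ball (Metric.mem_ball_self hs) (hT.massIn_slice_eq_zero hT' hρ r
      Metric.isOpen_ball.measurableSet
      (Eventually.of_forall fun n => measure_mono_null inter_subset_left hV)) hz

/-- Measurability in `r` is known on open sets, a π-system generating the Borel sets. It passes to
Borel sets for the finite measures obtained by restriction to `U n`, and the supremum over `n`
recovers the full mass. -/
theorem IsTight.aemeasurable_mass_slice {T : FormFunction Z (m + 1)} (hT : IsTight T)
    (hT' : IsTight (boundary T)) {ρ : Z → ℝ} (hρ : ∃ K : ℝ≥0, LipschitzWith K ρ) {A : Set Z}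
    (hA : MeasurableSet A) : AEMeasurable (fun r => mass (slice T ρ r) A) volume := by
  classical
  obtain ⟨U, hUm, hUo, hUb, hUu, -⟩ := exists_exhaustion Z
  obtain ⟨t, ht, htm, ht0⟩ := exists_measurable_superset_of_null
    (ae_iff.1 (hT.ae_isTight_slice hT' hρ))
  have htight : ∀ r, r ∉ t → IsTight (slice T ρ r) := fun r hr => by
    by_contra h
    exact hr (ht h)
  -- On the measurable null set `t`, containing every `r` whose slice is not tight, the family is
  -- set to zero.
  let κ : ℕ → ℝ → Measure Z := fun n r =>
    if r ∈ t then 0 else (massMeasure (slice T ρ r)).restrict (U n)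
  have hfin : ∀ n r, IsFiniteMeasure (κ n r) := fun n r => by
    by_cases hr : r ∈ t
    · simp only [κ, if_pos hr]
      infer_instance
    · simp only [κ, if_neg hr]
      exact ⟨by
        rw [Measure.restrict_apply_univ]
        exact (htight r hr).massMeasure_lt_top (hUb n)⟩
  have hopen : ∀ n V, IsOpen V → Measurable fun r => κ n r V := fun n V hV => by
    have : (fun r => κ n r V) = fun r => if r ∈ t then 0 else massIn (slice T ρ r) (V ∩ U n) := by
      ext r
      by_cases hr : r ∈ t
      · simp [κ, hr]
      · simp only [κ, if_neg hr]
        rw [Measure.restrict_apply hV.measurableSet,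
          (htight r hr).massMeasure_of_isOpen (hV.inter (hUo n))]
    rw [this]
    exact Measurable.ite htm measurable_const (hT.measurable_massIn_slice hT' hρ _)
  have hκ : ∀ n, Measurable (κ n) := fun n =>
    Measurable.measure_of_isPiSystem BorelSpace.measurable_eq isPiSystem_isOpen (hopen n)
      (hopen n univ isOpen_univ)
  refine ⟨fun r => ⨆ n, κ n r A,
    Measurable.iSup fun n => (Measure.measurable_coe hA).comp (hκ n), ?_⟩
  have hae : ∀ᵐ r, r ∉ t := measure_eq_zero_iff_ae_notMem.1 ht0
  filter_upwards [hae] with r hr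
  have hmono : Monotone fun n => A ∩ U n := fun i j hij => inter_subset_inter_right _ (hUm hij)
  rw [← (htight r hr).massMeasure_apply hA]
  conv_lhs => rw [← inter_univ A, ← hUu, inter_iUnion, hmono.measure_iUnion]
  refine iSup_congr fun n => ?_
  simp only [κ, if_neg hr]
  rw [Measure.restrict_apply hA]

/-- For almost every r in (r₀, r₁) the slice does not charge `A \ E`, because |ρ - r| is bounded
below there. So its mass on `A` is at most its mass in any open V ⊇ A ∩ E; the open coarea bound and
the infimum over V, which defines ‖T‖, finish. -/
theorem IsTight.lintegral_mass_slice_le {T : FormFunction Z (m + 1)} (hT : IsTight T)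
    (hT' : IsTight (boundary T)) {ρ : Z → ℝ} (hρ : ∃ K : ℝ≥0, LipschitzWith K ρ) {A : Set Z}
    (hA : MeasurableSet A) (r₀ r₁ : ℝ) :
    ∫⁻ r in Ioo r₀ r₁, mass (slice T ρ r) A ≤
      lipConst ρ * mass T (A ∩ {z | r₀ < ρ z ∧ ρ z < r₁}) := by
  have hc : Continuous ρ := hρ.choose_spec.continuous
  set E : Set Z := {z | r₀ < ρ z ∧ ρ z < r₁}
  have hE : IsOpen E := (isOpen_lt continuous_const hc).inter (isOpen_lt hc continuous_const)
  have key : ∀ V, IsOpen V → A ∩ E ⊆ V →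
      ∫⁻ r in Ioo r₀ r₁, mass (slice T ρ r) A ≤ lipConst ρ * massIn T V := by
    intro V hV hAV
    calc _ ≤ ∫⁻ r in Ioo r₀ r₁, massIn (slice T ρ r) V := by
          refine setLIntegral_mono_ae' measurableSet_Ioo ?_
          filter_upwards [hT.ae_isTight_slice hT' hρ] with r hr hrI
          -- On `A \ E` one has |ρ - r| ≥ min (r - r₀) (r₁ - r); halving makes the inequality
          -- strict, so it defines an open set.
          have hδ : 0 < min (r - r₀) (r₁ - r) / 2 :=
            half_pos (lt_min (sub_pos.2 hrI.1) (sub_pos.2 hrI.2))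
          set W : Set Z := {z | min (r - r₀) (r₁ - r) / 2 < |ρ z - r|}
          have hW : IsOpen W := isOpen_lt continuous_const (hc.sub continuous_const).abs
          have hAW : A \ E ⊆ W := fun z hz => by
            have h1 := min_le_left (r - r₀) (r₁ - r)
            have h2 := min_le_right (r - r₀) (r₁ - r)
            change min (r - r₀) (r₁ - r) / 2 < |ρ z - r|
            by_cases h : r₀ < ρ z
            · have h' : r₁ ≤ ρ z := not_lt.1 fun h' => hz.2 ⟨h, h'⟩
              exact lt_of_lt_of_le (by linarith) (le_abs_self _)
            · exact lt_of_lt_of_le (by linarith) (neg_le_abs _)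
          have hW0 : massMeasure (slice T ρ r) (A \ E) = 0 := by
            refine measure_mono_null hAW ?_
            rw [hr.massMeasure_of_isOpen hW]
            exact hT.massIn_slice_eq_zero_of_lt_abs hT' hρ r hW.measurableSet hδ fun z hz => hz
          rw [← hr.massMeasure_apply hA, ← measure_inter_add_sdiff A hE.measurableSet, hW0, add_zero,
            hr.massMeasure_apply (hA.inter hE.measurableSet)]
          exact mass_le_massIn _ hV hAV
      _ ≤ lipConst ρ * massMeasure T (V ∩ E) :=
          hT.lintegral_massIn_slice_le hT' hρ hV.measurableSet r₀ r₁
      _ ≤ _ := by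
          rw [← hT.massMeasure_of_isOpen hV]
          gcongr
          exact inter_subset_left
  -- To pass to the infimum one divides by Lip(ρ). If it is 0, taking V to be the whole space
  -- already bounds the integral by 0 · M_V = 0, even for infinite mass.
  rcases eq_or_ne (lipConst ρ : ℝ≥0∞) 0 with h0 | h0
  · have := key univ isOpen_univ (subset_univ _)
    rw [h0, zero_mul] at this ⊢
    exact this
  · rw [← ENNReal.div_le_iff' h0 ENNReal.coe_ne_top]
    exact le_iInf fun V => le_iInf fun hV => le_iInf fun hAV =>
      (ENNReal.div_le_iff' h0 ENNReal.coe_ne_top).2 (key V hV hAV)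

/-- Up to sign, the boundary of the slice is the slice of ∂T. Since ∂∂T = 0 is trivially tight, the
tightness result applies to ∂T as well. A slice of dimension 0 carries no boundary condition. -/
theorem ae_isLocallyNormal_slice {T : FormFunction Z (m + 1)} (hT : IsLocallyNormal T) {ρ : Z → ℝ}
    (hρ : ∃ K : ℝ≥0, LipschitzWith K ρ) : ∀ᵐ r, IsLocallyNormal (slice T ρ r) := by
  have h1 : IsTight T := hT.1.isTight
  have h2 : IsTight (boundary T) := hT.2.isTight
  cases m with
  | zero =>
    filter_upwards [h1.ae_isTight_slice h2 hρ] with r hr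
    exact hr.isLocallyFiniteMass
  | succ m =>
    have h3 : IsTight (boundary (boundary T)) := by
      rw [h1.1.boundary_boundary]
      exact isTight_zero
    filter_upwards [h1.ae_isTight_slice h2 hρ, h2.ae_isTight_slice h3 hρ] with r hr hr'
    refine ⟨hr.isLocallyFiniteMass, ?_⟩
    rw [h1.boundary_slice hρ]
    exact hr'.neg.isLocallyFiniteMass

end

end MetricCurrent

theorem mainTheorem7 {Z : Type*} [MetricSpace Z] [MeasurableSpace Z] [BorelSpace Z] (m : ℕ)
    (T : MetricCurrent.FormFunction Z (m + 1)) (hT : MetricCurrent.IsLocallyNormal T)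
    (ρ : Z → ℝ) (hρ : ∃ K : ℝ≥0, LipschitzWith K ρ) :
    (∀ᵐ r : ℝ, MetricCurrent.IsLocallyNormal (MetricCurrent.slice T ρ r) ∧
      MetricCurrent.spt (MetricCurrent.slice T ρ r) ⊆ {z | ρ z = r} ∩ MetricCurrent.spt T) ∧
    ∀ A : Set Z, MeasurableSet A →
      AEMeasurable (fun r : ℝ => MetricCurrent.mass (MetricCurrent.slice T ρ r) A) volume ∧
      ∀ r₀ r₁ : ℝ, r₀ < r₁ →
        ∫⁻ r in Ioo r₀ r₁, MetricCurrent.mass (MetricCurrent.slice T ρ r) A ≤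
          (MetricCurrent.lipConst ρ : ℝ≥0∞) *
            MetricCurrent.mass T (A ∩ {z | r₀ < ρ z ∧ ρ z < r₁}) := by
  have h1 : MetricCurrent.IsTight T := hT.1.isTight
  have h2 : MetricCurrent.IsTight (MetricCurrent.boundary T) := hT.2.isTight
  refine ⟨?_, fun A hA => ⟨h1.aemeasurable_mass_slice h2 hρ hA,
    fun r₀ r₁ _ => h1.lintegral_mass_slice_le h2 hρ hA r₀ r₁⟩⟩
  filter_upwards [MetricCurrent.ae_isLocallyNormal_slice hT hρ] with r hr
  exact ⟨hr, h1.spt_slice_subset h2 hρ r⟩
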